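/- Let $d\in\mathbb N$, $d\ge 1$, and $\alpha>0$. For $n\in\mathbb N_0^d$ write $|n|=n_1+\dots+n_d$ and let $h_n(x)=\prod_{j=1}^d h_{n_j}(x_j)$ be the Hermite functions on $\mathbb R^d$, where $h_k(t)=(2^k k!\sqrt\pi)^{-1/2}e^{-t^2/2}H_k(t)$ and $H_k(t)=(-1)^k e^{t^2}\frac{d^k}{dt^k}e^{-t^2}$. For $r>0$ let $X_r$ be the Banach space of all complex sequences $(a_n)_{n\in\mathbb N_0^d}$ with norm $\sup_n |a_n|e^{r|n|^{1/\alpha}}<\infty$. Let $\mathcal H_{\alpha/2}(\mathbb R^d)$ (Roumieu type) be the space of all Hermite series $\varphi=\sum_n a_n h_n$ with $(a_n)\in\bigcup_{r>0}X_r$, with the locally convex inductive limit topology transported from $\bigcup_{r>0}X_r$, and let $\mathcal H_{0,\alpha/2}(\mathbb R^d)$ (Beurling type) be the space of all $\varphi=\sum_n a_nh_n$ with $(a_n)\in\bigcap_{r>0}X_r$, with the projective limit topology; these series converge absolutely at every point, so their elements are functions on $\mathbb R^d$. Let $\mathcal A$ be $\mathcal H_{\alpha/2}(\mathbb R^d)$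 or $\mathcal H_{0,\alpha/2}(\mathbb R^d)$, and let $\mathcal A'$ be its strong dual. Let $\mathcal A_{radial}\subset\mathcal A$ be the subspace, with the topology induced by $\mathcal A$, of those $\varphi$ for which $\varphi(x)$ depends only on the Euclidean norm $|x|$, and let $(\mathcal A_{radial})'$ be its strong dual. Let $\mathcal A'_{radial}\subset\mathcal A'$ be the subspace, with the topology induced by $\mathcal A'$, of those $f$ with $\langle f,\varphi(A^{-1}\,\cdot\,)\rangle=\langle f,\varphi\rangle$ for all $\varphi\in\mathcal A$ and all $A\in O(d)$. Then $\mathcal A'_{radial}$ is topologically isomorphic to $(\mathcal A_{radial})'$; more precisely, the restriction map $f\mapsto f|_{\mathcal A_{radial}}$ is a linear homeomorphism from $\mathcal A'_{radial}$ onto $(\mathcal A_{radial})'$. -/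

import Mathlib

namespace Pilipovic

/-! ### Hermite functions -/

/-- The Hermite polynomial `H_n(x) = (-1)^n e^{x^2} (d/dx)^n e^{-x^2}`. -/
noncomputable def hermiteH (n : ℕ) (x : ℝ) : ℝ :=
  (-1) ^ n * Real.exp (x ^ 2) * iteratedDeriv n (fun y : ℝ => Real.exp (-y ^ 2)) x

/-- The Hermite function `h_n(x) = (2^n n! √π)^{-1/2} e^{-x^2/2} H_n(x)` on the real line. -/
noncomputable def hermiteFun (n : ℕ) (x : ℝ) : ℝ :=
  (Real.sqrt (2 ^ n * (n.factorial : ℝ) * Real.sqrt Real.pi))⁻¹ *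
    Real.exp (-x ^ 2 / 2) * hermiteH n x

/-- The Hermite function `h_n(x) = ∏_j h_{n_j}(x_j)` on `ℝ^d`, for a multi-index `n`. -/
noncomputable def hermiteFn {d : ℕ} (n : Fin d → ℕ) (x : EuclideanSpace ℝ (Fin d)) : ℝ :=
  ∏ j, hermiteFun (n j) (x j)

/-! ### Weighted sequence spaces -/

/-- The weight `ϑ_{r,s}(n) = exp (r |n|^{1/(2s)})`, where `|n| = n_1 + ... + n_d`. -/
noncomputable def weight {d : ℕ} (s r : ℝ) (n : Fin d → ℕ) : ℝ :=
  Real.exp (r * ((∑ j, n j : ℕ) : ℝ) ^ (1 / (2 * s)))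

theorem weight_pos {d : ℕ} (s r : ℝ) (n : Fin d → ℕ) : 0 < weight s r n := Real.exp_pos _

theorem weight_mono {d : ℕ} (s : ℝ) {r r' : ℝ} (h : r ≤ r') (n : Fin d → ℕ) :
    weight s r n ≤ weight s r' n :=
  Real.exp_le_exp.2 (mul_le_mul_of_nonneg_right h (Real.rpow_nonneg (Nat.cast_nonneg _) _))

/-- The sequences `a` such that `ϑ_{r,s} a` is bounded, as a subspace of all sequences. -/
noncomputable def weightedLinf (d : ℕ) (s r : ℝ) : Submodule ℂ ((Fin d → ℕ) → ℂ) where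
  carrier := {a | Memℓp (fun n => weight s r n • a n) ⊤}
  zero_mem' := by
    have h : (fun n : Fin d → ℕ => weight s r n • (0 : (Fin d → ℕ) → ℂ) n) = 0 := by
      ext n; simp
    change Memℓp (fun n => weight s r n • (0 : (Fin d → ℕ) → ℂ) n) ⊤
    rw [h]
    exact zero_memℓp
  add_mem' {a b} ha hb := by
    have h : (fun n => weight s r n • (a + b) n) =
        (fun n => weight s r n • a n) + fun n => weight s r n • b n := by
      ext n; exact smul_add _ _ _
    change Memℓp (fun n => weight s r n • (a + b) n) ⊤
    rw [h]
    exact Memℓp.add (show Memℓp (fun n => weight s r n • a n) ⊤ from ha)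
      (show Memℓp (fun n => weight s r n • b n) ⊤ from hb)
  smul_mem' c a ha := by
    have h : (fun n => weight s r n • (c • a) n) = c • fun n => weight s r n • a n := by
      ext n; exact smul_comm (weight s r n) c (a n)
    change Memℓp (fun n => weight s r n • (c • a) n) ⊤
    rw [h]
    exact Memℓp.const_smul (show Memℓp (fun n => weight s r n • a n) ⊤ from ha) c

theorem weightedLinf_anti (d : ℕ) (s : ℝ) {r r' : ℝ} (h : r ≤ r') :
    weightedLinf d s r' ≤ weightedLinf d s r := by
  intro a ha
  change Memℓp (fun n => weight s r n • a n) ⊤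
  obtain ⟨C, hC⟩ := (memℓp_infty_iff.1 (show Memℓp (fun n => weight s r' n • a n) ⊤ from ha))
  refine memℓp_infty_iff.2 ⟨C, ?_⟩
  rintro _ ⟨n, rfl⟩
  refine le_trans ?_ (hC ⟨n, rfl⟩)
  simp only [norm_smul, Real.norm_eq_abs, abs_of_pos (weight_pos _ _ _)]
  exact mul_le_mul_of_nonneg_right (weight_mono s h n) (norm_nonneg _)

/-- The Banach space `ℓ^∞_{[ϑ_{r,s}]}(ℕ_0^d)`, with norm `sup_n |a_n| ϑ_{r,s}(n)`. -/
def Step (d : ℕ) (s r : ℝ) : Type := ↥(weightedLinf d s r)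

noncomputable instance (d : ℕ) (s r : ℝ) : AddCommGroup (Step d s r) :=
  inferInstanceAs (AddCommGroup ↥(weightedLinf d s r))

noncomputable instance (d : ℕ) (s r : ℝ) : Module ℂ (Step d s r) :=
  inferInstanceAs (Module ℂ ↥(weightedLinf d s r))

/-- Multiplication by the weight, `a ↦ ϑ_{r,s} a`, into the bounded sequences. -/
noncomputable def Step.toLinf (d : ℕ) (s r : ℝ) :
    Step d s r →ₗ[ℂ] lp (fun _ : Fin d → ℕ => ℂ) ⊤ where
  toFun a := ⟨fun n => weight s r n • a.1 n, a.2⟩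
  map_add' a b := by
    ext n; exact smul_add (weight s r n) (a.1 n) (b.1 n)
  map_smul' c a := by
    ext n; exact smul_comm (weight s r n) c (a.1 n)

theorem Step.toLinf_injective (d : ℕ) (s r : ℝ) : Function.Injective (Step.toLinf d s r) := by
  intro a b h
  refine Subtype.ext (funext fun n => ?_)
  have h1 : weight s r n • a.1 n = weight s r n • b.1 n := congrFun (congrArg Subtype.val h) n
  exact smul_right_injective ℂ (weight_pos s r n).ne' h1

noncomputable instance (d : ℕ) (s r : ℝ) : NormedAddCommGroup (Step d s r) :=
  NormedAddCommGroup.induced _ _ (Step.toLinf d s r) (Step.toLinf_injective d s r)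

noncomputable instance (d : ℕ) (s r : ℝ) : NormedSpace ℂ (Step d s r) :=
  NormedSpace.induced ℂ _ _ (Step.toLinf d s r)

theorem Step.norm_def {d : ℕ} {s r : ℝ} (a : Step d s r) :
    ‖a‖ = ⨆ n, ‖a.1 n‖ * weight s r n := by
  change ‖Step.toLinf d s r a‖ = _
  rw [lp.norm_eq_ciSup]
  refine congrArg _ (funext fun n => ?_)
  change ‖weight s r n • a.1 n‖ = _
  rw [norm_smul, Real.norm_eq_abs, abs_of_pos (weight_pos _ _ _), mul_comm]

/-! ### Pointwise convergence of Hermite series -/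

/-- Derivatives of the Gaussian `e^{-x^2}`. -/
noncomputable def gaussD (n : ℕ) : ℝ → ℝ := iteratedDeriv n (fun y : ℝ => Real.exp (-y ^ 2))

theorem gaussD_hasDerivAt (n : ℕ) (x : ℝ) : HasDerivAt (gaussD n) (gaussD (n + 1) x) x := by
  have hc : ContDiff ℝ ((⊤ : ℕ∞) : WithTop ℕ∞) (fun y : ℝ => Real.exp (-y ^ 2)) := by fun_prop
  have hd : Differentiable ℝ (gaussD n) :=
    hc.differentiable_iteratedDeriv n (by exact_mod_cast WithTop.coe_lt_top n)
  have h := (hd x).hasDerivAt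
  have e : deriv (gaussD n) = gaussD (n + 1) := by
    unfold gaussD; rw [iteratedDeriv_succ]
  rwa [e] at h

theorem gaussD_zero (x : ℝ) : gaussD 0 x = Real.exp (-x ^ 2) := by simp [gaussD]

theorem gaussD_one (x : ℝ) : gaussD 1 x = -2 * x * gaussD 0 x := by
  have h1 := gaussD_hasDerivAt 0 x
  have h2 : HasDerivAt (gaussD 0) (Real.exp (-x ^ 2) * (-(2 * x))) x := by
    have e : gaussD 0 = fun y : ℝ => Real.exp (-y ^ 2) := funext gaussD_zero
    rw [e]
    simpa using ((hasDerivAt_pow 2 x).neg).exp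
  rw [h1.unique h2, gaussD_zero]; ring

theorem gaussD_succ_succ (n : ℕ) : ∀ x : ℝ,
    gaussD (n + 2) x = -2 * x * gaussD (n + 1) x - 2 * (n + 1) * gaussD n x := by
  induction n with
  | zero =>
    intro x
    have h1 := gaussD_hasDerivAt 1 x
    have h2 : HasDerivAt (gaussD 1) (-2 * 1 * gaussD 0 x + -2 * x * gaussD 1 x) x := by
      have e : gaussD 1 = fun y : ℝ => -2 * y * gaussD 0 y := funext gaussD_one
      conv in gaussD 1 => rw [e]
      exact ((hasDerivAt_id x).const_mul (-2)).mul (gaussD_hasDerivAt 0 x)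
    rw [h1.unique h2]; push_cast; ring
  | succ k ih =>
    intro x
    have h1 := gaussD_hasDerivAt (k + 2) x
    have h2 : HasDerivAt (gaussD (k + 2)) (-2 * 1 * gaussD (k + 1) x + -2 * x * gaussD (k + 2) x
        - 2 * (k + 1) * gaussD (k + 1) x) x := by
      have e : gaussD (k + 2) =
          fun y : ℝ => -2 * y * gaussD (k + 1) y - 2 * (k + 1) * gaussD k y := funext ih
      conv in gaussD (k + 2) => rw [e]
      exact (((hasDerivAt_id x).const_mul (-2)).mul (gaussD_hasDerivAt (k + 1) x)).sub
        ((gaussD_hasDerivAt k x).const_mul _)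
    rw [h1.unique h2]; push_cast; ring

/-- `h_n` up to its sign and its normalizing constant. -/
noncomputable def hermiteAux (n : ℕ) (x : ℝ) : ℝ := Real.exp (x ^ 2 / 2) * gaussD n x

/-- The derivative of `hermiteAux`. -/
noncomputable def hermiteAux' (n : ℕ) (x : ℝ) : ℝ :=
  Real.exp (x ^ 2 / 2) * (x * gaussD n x + gaussD (n + 1) x)

theorem exp_half_hasDerivAt (x : ℝ) :
    HasDerivAt (fun y : ℝ => Real.exp (y ^ 2 / 2)) (Real.exp (x ^ 2 / 2) * x) x := by
  have := ((hasDerivAt_pow 2 x).div_const 2).exp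
  simpa using this

theorem hermiteAux_hasDerivAt (n : ℕ) (x : ℝ) :
    HasDerivAt (hermiteAux n) (hermiteAux' n x) x := by
  have h := (exp_half_hasDerivAt x).mul (gaussD_hasDerivAt n x)
  refine h.congr_deriv ?_
  unfold hermiteAux'; ring

theorem hermiteAux'_hasDerivAt (n : ℕ) (x : ℝ) :
    HasDerivAt (hermiteAux' n) ((x ^ 2 - (2 * n + 1)) * hermiteAux n x) x := by
  have h := (exp_half_hasDerivAt x).mul
    (((hasDerivAt_id x).mul (gaussD_hasDerivAt n x)).add (gaussD_hasDerivAt (n + 1) x))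
  refine h.congr_deriv ?_
  have e := gaussD_succ_succ n x
  simp only [id, Pi.add_apply, Pi.mul_apply, hermiteAux]
  rw [show n + 1 + 1 = n + 2 from rfl, e]; ring

theorem hermiteAux_sq_le (n : ℕ) {x : ℝ} (hx : x ^ 2 ≤ 2 * n) :
    hermiteAux n x ^ 2 ≤ gaussD (n + 1) 0 ^ 2 + (2 * n + 1) * gaussD n 0 ^ 2 := by
  set F : ℝ → ℝ := fun y => hermiteAux' n y ^ 2 + (2 * n + 1 - y ^ 2) * hermiteAux n y ^ 2
  have hF : ∀ y, HasDerivAt F (-2 * y * hermiteAux n y ^ 2) y := by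
    intro y
    have h := ((hermiteAux'_hasDerivAt n y).pow 2).add
      (((hasDerivAt_const y (2 * (n : ℝ) + 1)).sub (hasDerivAt_pow 2 y)).mul
        ((hermiteAux_hasDerivAt n y).pow 2))
    refine h.congr_deriv ?_
    simp; ring
  have hcont : Continuous F := continuous_iff_continuousAt.2 fun y => (hF y).continuousAt
  have hdiff : Differentiable ℝ F := fun y => (hF y).differentiableAt
  have h0 : F x ≤ F 0 := by
    rcases le_total 0 x with h | h
    · have : AntitoneOn F (Set.Ici 0) := by
        refine antitoneOn_of_deriv_nonpos (convex_Ici 0) hcont.continuousOn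
          hdiff.differentiableOn fun y hy => ?_
        rw [interior_Ici] at hy
        rw [(hF y).deriv]
        have h1 : 0 < y := hy
        nlinarith [mul_nonneg h1.le (sq_nonneg (hermiteAux n y))]
      exact this Set.self_mem_Ici h h
    · have : MonotoneOn F (Set.Iic 0) := by
        refine monotoneOn_of_deriv_nonneg (convex_Iic 0) hcont.continuousOn
          hdiff.differentiableOn fun y hy => ?_
        rw [interior_Iic] at hy
        rw [(hF y).deriv]
        have h1 : y < 0 := hy
        nlinarith [mul_nonneg (neg_nonneg.2 h1.le) (sq_nonneg (hermiteAux n y))]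
      exact this h Set.self_mem_Iic h
  have h1 : F 0 = gaussD (n + 1) 0 ^ 2 + (2 * n + 1) * gaussD n 0 ^ 2 := by
    simp [F, hermiteAux, hermiteAux']
  have h2 : hermiteAux n x ^ 2 ≤ F x := by
    simp only [F]
    nlinarith [sq_nonneg (hermiteAux' n x), sq_nonneg (hermiteAux n x),
      mul_nonneg (sub_nonneg.2 hx) (sq_nonneg (hermiteAux n x))]
  linarith

theorem gaussD_at_zero_sq (n : ℕ) :
    gaussD n 0 ^ 2 ≤ 2 ^ n * (n.factorial : ℝ) ∧
      gaussD (n + 1) 0 ^ 2 ≤ 2 ^ (n + 1) * ((n + 1).factorial : ℝ) := by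
  induction n with
  | zero => simp [gaussD_zero, gaussD_one]
  | succ k ih =>
    refine ⟨ih.2, ?_⟩
    have e := gaussD_succ_succ k 0
    rw [show k + 1 + 1 = k + 2 from rfl, e, Nat.factorial_succ, Nat.factorial_succ]
    push_cast
    have h := ih.1
    have hk : (0 : ℝ) ≤ k := Nat.cast_nonneg k
    have hp : (0 : ℝ) ≤ 2 ^ k * (k.factorial : ℝ) := by positivity
    have h3 : 4 * ((k : ℝ) + 1) ^ 2 * gaussD k 0 ^ 2 ≤
        4 * ((k : ℝ) + 1) ^ 2 * (2 ^ k * (k.factorial : ℝ)) :=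
      mul_le_mul_of_nonneg_left h (by positivity)
    have h4 : (0 : ℝ) ≤ ((k : ℝ) + 1) * (2 ^ k * (k.factorial : ℝ)) := by positivity
    calc _ = 4 * ((k : ℝ) + 1) ^ 2 * gaussD k 0 ^ 2 := by ring
      _ ≤ _ := h3
      _ ≤ 4 * ((k : ℝ) + 1) ^ 2 * (2 ^ k * (k.factorial : ℝ)) +
          4 * (((k : ℝ) + 1) * (2 ^ k * (k.factorial : ℝ))) := by linarith
      _ = _ := by ring

theorem hermiteFun_sq (n : ℕ) (x : ℝ) :
    hermiteFun n x ^ 2 =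
      hermiteAux n x ^ 2 / (2 ^ n * (n.factorial : ℝ) * Real.sqrt Real.pi) := by
  have hE : Real.exp (-x ^ 2 / 2) * Real.exp (x ^ 2) = Real.exp (x ^ 2 / 2) := by
    rw [← Real.exp_add]; congr 1; ring
  have h1 : hermiteFun n x = (Real.sqrt (2 ^ n * (n.factorial : ℝ) * Real.sqrt Real.pi))⁻¹ *
      ((-1) ^ n * hermiteAux n x) := by
    unfold hermiteFun hermiteH hermiteAux
    rw [← hE]; unfold gaussD; ring
  rw [h1, mul_pow, inv_pow, Real.sq_sqrt (by positivity), mul_pow, ← pow_mul, mul_comm n 2,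
    pow_mul]
  simp [div_eq_inv_mul]

theorem hermiteFun_abs_le (n : ℕ) {x : ℝ} (hx : x ^ 2 ≤ 2 * n) :
    |hermiteFun n x| ≤ 4 * (n + 1) := by
  have hn : (0 : ℝ) ≤ n := Nat.cast_nonneg n
  have hpi : 1 ≤ Real.sqrt Real.pi := Real.one_le_sqrt.2 (by linarith [Real.pi_gt_three])
  have hp : (0 : ℝ) < 2 ^ n * (n.factorial : ℝ) := by positivity
  have h1 : hermiteAux n x ^ 2 ≤ (4 * n + 3) * (2 ^ n * (n.factorial : ℝ)) := by
    have h := hermiteAux_sq_le n hx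
    have ⟨ha, hb⟩ := gaussD_at_zero_sq n
    rw [Nat.factorial_succ, pow_succ 2 n] at hb
    push_cast at hb
    have := mul_le_mul_of_nonneg_left ha (show (0 : ℝ) ≤ 2 * n + 1 by positivity)
    nlinarith
  refine abs_le_of_sq_le_sq ?_ (by positivity)
  rw [hermiteFun_sq, div_le_iff₀ (by positivity)]
  calc _ ≤ (4 * n + 3) * (2 ^ n * (n.factorial : ℝ)) := h1
    _ ≤ (4 * (n + 1)) ^ 2 * (2 ^ n * (n.factorial : ℝ)) :=
        mul_le_mul_of_nonneg_right (by nlinarith) hp.le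
    _ = (4 * (n + 1)) ^ 2 * (2 ^ n * (n.factorial : ℝ)) * 1 := by ring
    _ ≤ (4 * (n + 1)) ^ 2 * (2 ^ n * (n.factorial : ℝ)) * Real.sqrt Real.pi :=
        mul_le_mul_of_nonneg_left hpi (by positivity)
    _ = _ := by ring

theorem summable_hermiteFun_mul {c p : ℝ} (hc : 0 < c) (hp : 0 < p) (x : ℝ) :
    Summable fun n : ℕ => |hermiteFun n x| * Real.exp (-c * (n : ℝ) ^ p) := by
  have hexp : (fun n : ℕ => Real.exp (-c * (n : ℝ) ^ p)) =O[Filter.atTop]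
      fun n : ℕ => (n : ℝ) ^ (-3 : ℝ) := by
    have h := (isLittleO_exp_neg_mul_rpow_atTop hc (-3 / p)).comp_tendsto
      ((tendsto_rpow_atTop hp).comp tendsto_natCast_atTop_atTop)
    refine h.isBigO.congr (fun n => rfl) fun n => ?_
    simp only [Function.comp_apply]
    rw [← Real.rpow_mul (Nat.cast_nonneg n)]
    congr 1; field_simp
  have hh : (fun n : ℕ => |hermiteFun n x|) =O[Filter.atTop] fun n : ℕ => (n : ℝ) := by
    refine Asymptotics.IsBigO.of_bound 8 ?_
    obtain ⟨M, hM⟩ := exists_nat_ge (x ^ 2)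
    filter_upwards [Filter.eventually_ge_atTop (M + 1)] with n hn
    have h1 : (M : ℝ) + 1 ≤ n := by exact_mod_cast hn
    have hM0 : (0 : ℝ) ≤ M := Nat.cast_nonneg M
    have := hermiteFun_abs_le n (x := x) (by linarith)
    rw [Real.norm_eq_abs, abs_abs, Real.norm_eq_abs, abs_of_nonneg (show (0 : ℝ) ≤ n from Nat.cast_nonneg n)]
    linarith
  refine summable_of_isBigO_nat (g := fun n : ℕ => (n : ℝ) ^ (-2 : ℝ))
    (Real.summable_nat_rpow.2 (by norm_num)) ?_
  refine (hh.mul hexp).trans_eventuallyEq ?_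
  filter_upwards [Filter.eventually_ge_atTop 1] with n hn
  have h1 : (0 : ℝ) < n := by exact_mod_cast hn
  calc (n : ℝ) * (n : ℝ) ^ (-3 : ℝ) = (n : ℝ) ^ (1 : ℝ) * (n : ℝ) ^ (-3 : ℝ) := by
        rw [Real.rpow_one]
    _ = _ := by rw [← Real.rpow_add h1]; norm_num

theorem summable_pi_prod {d : ℕ} {f : Fin d → ℕ → ℝ} (h0 : ∀ j n, 0 ≤ f j n)
    (hf : ∀ j, Summable (f j)) : Summable fun n : Fin d → ℕ => ∏ j, f j (n j) := by
  refine summable_of_sum_le (c := ∏ j, ∑' n, f j n)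
    (fun n => Finset.prod_nonneg fun j _ => h0 j _) fun u => ?_
  classical
  have hu : u ⊆ Fintype.piFinset fun j => u.image fun n => n j := fun n hn =>
    Fintype.mem_piFinset.2 fun j => Finset.mem_image_of_mem _ hn
  calc _ ≤ ∑ n ∈ Fintype.piFinset fun j => u.image fun n => n j, ∏ j, f j (n j) :=
        Finset.sum_le_sum_of_subset_of_nonneg hu fun n _ _ =>
          Finset.prod_nonneg fun j _ => h0 j _
    _ = ∏ j, ∑ k ∈ u.image fun n => n j, f j k := (Finset.prod_univ_sum _ _).symm
    _ ≤ _ := Finset.prod_le_prod (fun j _ => Finset.sum_nonneg fun k _ => h0 j k)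
        fun j _ => (hf j).sum_le_tsum _ fun k _ => h0 j k

/-- The Hermite series of a sequence in `ℓ^∞_{[ϑ_{r,s}]}` converges absolutely at every point. -/
theorem summable_hermite_series {d : ℕ} {s r : ℝ} (hs : 0 < s) (hr : 0 < r)
    {a : (Fin d → ℕ) → ℂ} (ha : a ∈ weightedLinf d s r) (x : EuclideanSpace ℝ (Fin d)) :
    Summable fun n => a n * (hermiteFn n x : ℂ) := by
  obtain ⟨C, hC⟩ := memℓp_infty_iff.1 (show Memℓp (fun n => weight s r n • a n) ⊤ from ha)
  have hp : 0 < 1 / (2 * s) := by positivity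
  set p := 1 / (2 * s) with hpdef
  have hd : (0 : ℝ) < d + 1 := by positivity
  have hsum := summable_pi_prod (d := d)
    (f := fun j n => |hermiteFun n (x j)| * Real.exp (-(r / (d + 1)) * (n : ℝ) ^ p))
    (fun j n => by positivity)
    (fun j => summable_hermiteFun_mul (div_pos hr hd) hp (x j))
  refine Summable.of_norm_bounded (hsum.mul_left C) fun n => ?_
  have h1 : weight s r n * ‖a n‖ ≤ C := by
    have := hC ⟨n, rfl⟩
    simpa only [norm_smul, Real.norm_eq_abs, abs_of_pos (weight_pos _ _ _)] using this
  have h2 : (∏ j, Real.exp (-(r / (d + 1)) * (n j : ℝ) ^ p)) * weight s r n ≥ 1 := by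
    rw [← Real.exp_sum, weight, ← Real.exp_add, ge_iff_le, Real.one_le_exp_iff, ← hpdef,
      ← Finset.mul_sum]
    have h3 : ∑ j, (n j : ℝ) ^ p ≤ (d + 1) * ((∑ j, n j : ℕ) : ℝ) ^ p := by
      have h4 : ∀ j ∈ Finset.univ, (n j : ℝ) ^ p ≤ ((∑ j, n j : ℕ) : ℝ) ^ p := fun j hj =>
        Real.rpow_le_rpow (Nat.cast_nonneg _)
          (Nat.cast_le.2 (Finset.single_le_sum (fun _ _ => Nat.zero_le _) hj)) hp.le
      have h5 := Finset.sum_le_card_nsmul _ _ _ h4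
      rw [Finset.card_univ, Fintype.card_fin, nsmul_eq_mul] at h5
      have h6 : 0 ≤ ((∑ j, n j : ℕ) : ℝ) ^ p := Real.rpow_nonneg (Nat.cast_nonneg _) _
      linarith
    have h7 := mul_le_mul_of_nonneg_left h3 (div_pos hr hd).le
    have h8 : r / (d + 1) * ((d + 1) * ((∑ j, n j : ℕ) : ℝ) ^ p) =
        r * ((∑ j, n j : ℕ) : ℝ) ^ p := by field_simp
    linarith
  set E := ∏ j, Real.exp (-(r / (d + 1)) * (n j : ℝ) ^ p) with hE
  have hE0 : 0 < E := Finset.prod_pos fun j _ => Real.exp_pos _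
  have h9 : ‖a n‖ ≤ C * E := by
    calc ‖a n‖ = 1 * ‖a n‖ := (one_mul _).symm
      _ ≤ E * weight s r n * ‖a n‖ := mul_le_mul_of_nonneg_right h2 (norm_nonneg _)
      _ = E * (weight s r n * ‖a n‖) := by ring
      _ ≤ E * C := mul_le_mul_of_nonneg_left h1 hE0.le
      _ = C * E := mul_comm _ _
  rw [norm_mul, Complex.norm_real, Real.norm_eq_abs, hermiteFn, Finset.abs_prod,
    Finset.prod_mul_distrib, ← hE]
  calc _ ≤ C * E * ∏ j, |hermiteFun (n j) (x j)| :=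
        mul_le_mul_of_nonneg_right h9 (Finset.prod_nonneg fun j _ => abs_nonneg _)
    _ = _ := by ring

/-- The function `x ↦ ∑_n a_n h_n(x)`, as a linear function of the coefficients `a`, on a space
of sequences for which the series converge. -/
noncomputable def hermiteSum {d : ℕ} (V : Submodule ℂ ((Fin d → ℕ) → ℂ))
    (hV : ∀ a ∈ V, ∀ x : EuclideanSpace ℝ (Fin d), Summable fun n => a n * (hermiteFn n x : ℂ)) :
    V →ₗ[ℂ] (EuclideanSpace ℝ (Fin d) → ℂ) where
  toFun a x := ∑' n, a.1 n * (hermiteFn n x : ℂ)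
  map_add' a b := by
    ext x
    simp only [Submodule.coe_add, Pi.add_apply, add_mul]
    exact (hV a.1 a.2 x).tsum_add (hV b.1 b.2 x)
  map_smul' c a := by
    ext x
    simp only [Submodule.coe_smul, Pi.smul_apply, smul_eq_mul, mul_assoc, RingHom.id_apply]
    exact tsum_mul_left

/-! ### The space of Roumieu type -/

/-- The sequence space `ℓ_s(ℕ_0^d) = ⋃_{r > 0} ℓ^∞_{[ϑ_{r,s}]}(ℕ_0^d)`. -/
noncomputable def roumieuSeq (d : ℕ) (s : ℝ) : Submodule ℂ ((Fin d → ℕ) → ℂ) where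
  carrier := {a | ∃ r : ℝ, 0 < r ∧ a ∈ weightedLinf d s r}
  zero_mem' := ⟨1, one_pos, zero_mem _⟩
  add_mem' := by
    rintro a b ⟨r, hr, ha⟩ ⟨r', hr', hb⟩
    exact ⟨min r r', lt_min hr hr', add_mem (weightedLinf_anti d s (min_le_left _ _) ha)
      (weightedLinf_anti d s (min_le_right _ _) hb)⟩
  smul_mem' := by
    rintro c a ⟨r, hr, ha⟩
    exact ⟨r, hr, Submodule.smul_mem _ c ha⟩

/-- The Pilipović space `𝓗_s(ℝ^d)` of Roumieu type. An element is a Hermite series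
`∑_n a_n h_n`, given by its coefficient sequence `a ∈ ℓ_s(ℕ_0^d)`; see `Roumieu.eval` for the
function that it represents. -/
def Roumieu (d : ℕ) (s : ℝ) : Type := ↥(roumieuSeq d s)

namespace Roumieu

variable {d : ℕ} {s : ℝ}

noncomputable instance : AddCommGroup (Roumieu d s) := inferInstanceAs (AddCommGroup ↥(roumieuSeq d s))

noncomputable instance : Module ℂ (Roumieu d s) := inferInstanceAs (Module ℂ ↥(roumieuSeq d s))

/-- The coefficient sequence of a Hermite series. -/
noncomputable def coeff : Roumieu d s →ₗ[ℂ] ((Fin d → ℕ) → ℂ) := (roumieuSeq d s).subtype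

/-- The inclusion of `ℓ^∞_{[ϑ_{r,s}]}` into the union over all `r > 0`. -/
noncomputable def ofStep {r : ℝ} (hr : 0 < r) : Step d s r →ₗ[ℂ] Roumieu d s :=
  Submodule.inclusion (show weightedLinf d s r ≤ roumieuSeq d s from fun _ ha => ⟨r, hr, ha⟩)

/-- The function `x ↦ ∑_n a_n h_n(x)` on `ℝ^d` represented by a Hermite series. -/
noncomputable def eval (hs : 0 < s) : Roumieu d s →ₗ[ℂ] (EuclideanSpace ℝ (Fin d) → ℂ) :=
  hermiteSum (roumieuSeq d s) fun _ ⟨_, hr, ha⟩ x => summable_hermite_series hs hr ha x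

/-- The inductive limit topology (in the category of locally convex spaces): the finest locally
convex vector space topology for which every inclusion `ofStep` is continuous. -/
noncomputable instance : TopologicalSpace (Roumieu d s) :=
  sInf {t : TopologicalSpace (Roumieu d s) |
    (∀ (r : ℝ) (hr : 0 < r), @Continuous _ _ _ t (ofStep (d := d) (s := s) hr)) ∧
    @IsTopologicalAddGroup (Roumieu d s) t _ ∧
    @ContinuousSMul ℂ (Roumieu d s) _ _ t ∧
    @LocallyConvexSpace ℝ (Roumieu d s) _ _ _ _ t}

noncomputable instance : IsTopologicalAddGroup (Roumieu d s) :=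
  topologicalAddGroup_sInf fun _ ht => ht.2.1

noncomputable instance : ContinuousSMul ℂ (Roumieu d s) :=
  continuousSMul_sInf fun _ ht => ht.2.2.1

noncomputable instance : LocallyConvexSpace ℝ (Roumieu d s) :=
  .sInf fun _ ht => ht.2.2.2

end Roumieu

/-! ### The space of Beurling type -/

/-- The sequence space `ℓ_{0,s}(ℕ_0^d) = ⋂_{r > 0} ℓ^∞_{[ϑ_{r,s}]}(ℕ_0^d)`. -/
noncomputable def beurlingSeq (d : ℕ) (s : ℝ) : Submodule ℂ ((Fin d → ℕ) → ℂ) where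
  carrier := {a | ∀ r : ℝ, 0 < r → a ∈ weightedLinf d s r}
  zero_mem' := fun _ _ => zero_mem _
  add_mem' := fun ha hb r hr => add_mem (ha r hr) (hb r hr)
  smul_mem' := fun c _ ha r hr => Submodule.smul_mem _ c (ha r hr)

/-- The Pilipović space `𝓗_{0,s}(ℝ^d)` of Beurling type. An element is a Hermite series
`∑_n a_n h_n`, given by its coefficient sequence `a ∈ ℓ_{0,s}(ℕ_0^d)`; see `Beurling.eval` for
the function that it represents. -/
def Beurling (d : ℕ) (s : ℝ) : Type := ↥(beurlingSeq d s)

namespace Beurling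

variable {d : ℕ} {s : ℝ}

noncomputable instance : AddCommGroup (Beurling d s) := inferInstanceAs (AddCommGroup ↥(beurlingSeq d s))

noncomputable instance : Module ℂ (Beurling d s) := inferInstanceAs (Module ℂ ↥(beurlingSeq d s))

/-- The coefficient sequence of a Hermite series. -/
noncomputable def coeff : Beurling d s →ₗ[ℂ] ((Fin d → ℕ) → ℂ) := (beurlingSeq d s).subtype

/-- The inclusion of the intersection over all `r > 0` into `ℓ^∞_{[ϑ_{r,s}]}`. -/
noncomputable def toStep {r : ℝ} (hr : 0 < r) : Beurling d s →ₗ[ℂ] Step d s r :=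
  Submodule.inclusion (show beurlingSeq d s ≤ weightedLinf d s r from fun _ ha => ha r hr)

/-- The function `x ↦ ∑_n a_n h_n(x)` on `ℝ^d` represented by a Hermite series. -/
noncomputable def eval (hs : 0 < s) : Beurling d s →ₗ[ℂ] (EuclideanSpace ℝ (Fin d) → ℂ) :=
  hermiteSum (beurlingSeq d s) fun _ ha x => summable_hermite_series hs one_pos (ha 1 one_pos) x

/-- The projective limit topology: the coarsest one for which every `toStep` is continuous. -/
noncomputable instance : TopologicalSpace (Beurling d s) :=
  ⨅ (r : ℝ) (hr : 0 < r), TopologicalSpace.induced (toStep (d := d) (s := s) hr) inferInstance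

noncomputable instance : IsTopologicalAddGroup (Beurling d s) :=
  topologicalAddGroup_iInf fun _ => topologicalAddGroup_iInf fun hr =>
    topologicalAddGroup_induced (toStep hr)

noncomputable instance : ContinuousSMul ℂ (Beurling d s) :=
  continuousSMul_iInf fun _ => continuousSMul_iInf fun hr =>
    continuousSMul_induced (toStep hr)

noncomputable instance : LocallyConvexSpace ℝ (Beurling d s) :=
  .iInf fun _ => .iInf fun hr => .induced ((toStep hr).restrictScalars ℝ)

end Beurling

/-! ### Radial test functions and radial ultradistributions

Here `𝒜` is a space of test functions on `ℝ^d` and `ev` sends an element of `𝒜` to the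
function that it is. -/

section Radial

variable {d : ℕ} {𝒜 : Type} [AddCommGroup 𝒜] [Module ℂ 𝒜]

/-- The space `𝒜_radial` of the `φ` whose value at `x` depends only on `|x|`. -/
def radialTest (ev : 𝒜 →ₗ[ℂ] (EuclideanSpace ℝ (Fin d) → ℂ)) : Submodule ℂ 𝒜 where
  carrier := {φ | ∃ g : NNReal → ℂ, ∀ x, ev φ x = g ‖x‖₊}
  zero_mem' := ⟨0, fun x => by simp⟩
  add_mem' := by
    rintro φ ψ ⟨g, hg⟩ ⟨k, hk⟩
    exact ⟨g + k, fun x => by simp [hg, hk]⟩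
  smul_mem' := by
    rintro c φ ⟨g, hg⟩
    exact ⟨c • g, fun x => by simp [hg]⟩

/-- The space `𝒜'_radial` of the `f ∈ 𝒜'` with `⟨f, φ(A⁻¹ ·)⟩ = ⟨f, φ⟩` for all `A ∈ O(d)` and
all `φ ∈ 𝒜`. The element of `𝒜` that is the function `φ(A⁻¹ ·)` is called `ψ`. -/
def radialDual [TopologicalSpace 𝒜] (ev : 𝒜 →ₗ[ℂ] (EuclideanSpace ℝ (Fin d) → ℂ)) :
    Submodule ℂ (StrongDual ℂ 𝒜) where
  carrier := {f | ∀ A : Matrix.orthogonalGroup (Fin d) ℝ, ∀ φ ψ : 𝒜,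
    (∀ x, ev ψ x = ev φ (Matrix.toEuclideanLin (A⁻¹).1 x)) → f ψ = f φ}
  zero_mem' := fun _ _ _ _ => rfl
  add_mem' := by
    intro f g hf hg A φ ψ h
    exact congrArg₂ (· + ·) (hf A φ ψ h) (hg A φ ψ h)
  smul_mem' := by
    intro c f hf A φ ψ h
    exact congrArg (c • ·) (hf A φ ψ h)

end Radial

end Pilipovic

namespace Pilipovic

open MeasureTheory Polynomial

/-! ### Orthonormality of the Hermite functions on the line -/

/-! The restriction map has an explicit inverse: composition with a continuous projection `P` of the
test space onto its radial elements. Averaging over O(d) would give such a projection; here it is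
built from coefficients instead, with no Haar measure.

The key fact is that an isometry of ℝ^d maps each h_m to a finite combination of the h_k with |k| =
|m| (`hermiteFn_comp`), with a real orthogonal coefficient matrix (`rotCoeff_symm`). It holds
because h_0 depends only on |x|, the recursions for h_n express multiplication by a coordinate, and
the h_n are orthonormal. Isometries therefore act on coefficient sequences by finite blocks, one for
each order N. A test function is radial exactly when its coefficients are invariant in every block
(`coeff_mem_invSeq`, `mem_radialTest`), and a radial functional f has an invariant sequence f(h_n)
(`apply_unit_mem_invSeq`).

Let `seqProj` be the orthogonal projection onto the invariant vectors in each block. It does not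
distinguish a sequence from its rotations (`seqProj_eq_of_rotCoeff`), so g ∘ P is a radial
functional for every g on the radial space. It is self-adjoint, so f ∘ P = f for radial f
(`apply_proj`). In the sup norm a block costs at most its cardinality, which is absorbed by an
arbitrarily small decrease of r (`norm_seqProj_mul_weight_le`); both limit spaces allow that loss,
so `P` is continuous. Restriction and g ↦ g ∘ P are transposes of continuous linear maps, hence
continuous for the strong topologies, and they are mutually inverse. -/

theorem exists_gaussD_eq_eval (n : ℕ) :
    ∃ p : ℝ[X], ∀ x, gaussD n x = p.eval x * Real.exp (-x ^ 2) := by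
  induction n using Nat.twoStepInduction with
  | zero => exact ⟨1, fun x => by simp [gaussD_zero]⟩
  | one => exact ⟨-2 * X, fun x => by simp [gaussD_one, gaussD_zero]⟩
  | more n ih1 ih2 =>
    obtain ⟨p, hp⟩ := ih1
    obtain ⟨q, hq⟩ := ih2
    refine ⟨-2 * X * q - C (2 * ((n : ℝ) + 1)) * p, fun x => ?_⟩
    rw [gaussD_succ_succ, hp, hq]
    simp only [eval_sub, eval_mul, eval_neg, eval_X, eval_C, eval_ofNat]
    ring

theorem integrable_eval_mul_exp_neg_sq (p : ℝ[X]) :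
    Integrable fun x : ℝ => p.eval x * Real.exp (-x ^ 2) := by
  induction p using Polynomial.induction_on' with
  | add p q hp hq =>
    exact (hp.add hq).congr (.of_forall fun x => by simp [add_mul])
  | monomial n a =>
    have h := (integrable_rpow_mul_exp_neg_mul_sq one_pos
      (s := n) (by linarith [n.cast_nonneg (α := ℝ)])).const_mul a
    refine h.congr (.of_forall fun x => ?_)
    simp [mul_assoc]

theorem exp_sq_mul_exp_neg_sq (x : ℝ) : Real.exp (x ^ 2) * Real.exp (-x ^ 2) = 1 := by
  rw [← Real.exp_add]; simp

theorem integrable_exp_sq_mul_gaussD_mul_gaussD (m n : ℕ) :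
    Integrable fun x : ℝ => Real.exp (x ^ 2) * gaussD m x * gaussD n x := by
  obtain ⟨p, hp⟩ := exists_gaussD_eq_eval m
  obtain ⟨q, hq⟩ := exists_gaussD_eq_eval n
  refine (integrable_eval_mul_exp_neg_sq (p * q)).congr (.of_forall fun x => ?_)
  simp only [hp, hq, eval_mul]
  linear_combination (-(p.eval x * q.eval x * Real.exp (-x ^ 2))) * exp_sq_mul_exp_neg_sq x

theorem exp_sq_hasDerivAt (x : ℝ) :
    HasDerivAt (fun y : ℝ => Real.exp (y ^ 2)) (Real.exp (x ^ 2) * (2 * x)) x := by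
  simpa using (hasDerivAt_pow 2 x).exp

theorem exp_sq_mul_gaussD_zero_hasDerivAt (x : ℝ) :
    HasDerivAt (fun y => Real.exp (y ^ 2) * gaussD 0 y) 0 x := by
  refine ((exp_sq_hasDerivAt x).mul (gaussD_hasDerivAt 0 x)).congr_deriv ?_
  rw [gaussD_one]; ring

/-- Up to the sign (-1)^m the function e^{x²} `gaussD m` is the Hermite polynomial H_m, so this is
H_{m+1}' = 2(m+1) H_m. -/
theorem exp_sq_mul_gaussD_succ_hasDerivAt (m : ℕ) (x : ℝ) :
    HasDerivAt (fun y => Real.exp (y ^ 2) * gaussD (m + 1) y)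
      (-(2 * (m + 1)) * (Real.exp (x ^ 2) * gaussD m x)) x := by
  refine ((exp_sq_hasDerivAt x).mul (gaussD_hasDerivAt (m + 1) x)).congr_deriv ?_
  rw [show m + 1 + 1 = m + 2 from rfl, gaussD_succ_succ]; ring

theorem integral_exp_sq_mul_gaussD_zero_succ (n : ℕ) :
    ∫ x : ℝ, Real.exp (x ^ 2) * gaussD 0 x * gaussD (n + 1) x = 0 := by
  have h := integral_mul_deriv_eq_deriv_mul_of_integrable
    (u := fun y => Real.exp (y ^ 2) * gaussD 0 y) (u' := fun _ => 0)
    (fun x _ => exp_sq_mul_gaussD_zero_hasDerivAt x) (fun x _ => gaussD_hasDerivAt n x)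
    (integrable_exp_sq_mul_gaussD_mul_gaussD 0 (n + 1))
    ((integrable_zero ℝ ℝ volume).congr (.of_forall fun x => by simp))
    (integrable_exp_sq_mul_gaussD_mul_gaussD 0 n)
  simpa using h

theorem integral_exp_sq_mul_gaussD_succ_succ (m n : ℕ) :
    ∫ x : ℝ, Real.exp (x ^ 2) * gaussD (m + 1) x * gaussD (n + 1) x =
      2 * (m + 1) * ∫ x : ℝ, Real.exp (x ^ 2) * gaussD m x * gaussD n x := by
  have hi := (integrable_exp_sq_mul_gaussD_mul_gaussD m n).const_mul (-(2 * ((m : ℝ) + 1)))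
  have h := integral_mul_deriv_eq_deriv_mul_of_integrable
    (u := fun y => Real.exp (y ^ 2) * gaussD (m + 1) y)
    (u' := fun y => -(2 * ((m : ℝ) + 1)) * (Real.exp (y ^ 2) * gaussD m y))
    (fun x _ => exp_sq_mul_gaussD_succ_hasDerivAt m x) (fun x _ => gaussD_hasDerivAt n x)
    (integrable_exp_sq_mul_gaussD_mul_gaussD (m + 1) (n + 1))
    (hi.congr (.of_forall fun x => by simp only [Pi.mul_apply]; ring))
    (integrable_exp_sq_mul_gaussD_mul_gaussD (m + 1) n)
  rw [h, ← integral_const_mul, ← integral_neg]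
  refine integral_congr_ae (.of_forall fun x => ?_)
  simp only; ring

/-- Each integration by parts lowers both indices by one. The descent ends at the Gaussian integral
if m = n, and otherwise at the integral of a derivative, which vanishes. -/
theorem integral_exp_sq_mul_gaussD_mul_gaussD (m n : ℕ) :
    ∫ x : ℝ, Real.exp (x ^ 2) * gaussD m x * gaussD n x =
      if m = n then 2 ^ n * (n.factorial : ℝ) * Real.sqrt Real.pi else 0 := by
  induction n generalizing m with
  | zero =>
    cases m with
    | zero =>
      simp only [gaussD_zero, exp_sq_mul_exp_neg_sq, one_mul]
      simpa using integral_gaussian 1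
    | succ m =>
      rw [if_neg (by omega), ← integral_exp_sq_mul_gaussD_zero_succ m]
      refine integral_congr_ae (.of_forall fun x => ?_)
      simp only; ring
  | succ n ih =>
    cases m with
    | zero => rw [integral_exp_sq_mul_gaussD_zero_succ, if_neg (by omega)]
    | succ m =>
      rw [integral_exp_sq_mul_gaussD_succ_succ, ih]
      simp only [Nat.add_right_cancel_iff]
      split_ifs with h
      · subst h; rw [Nat.factorial_succ]; push_cast; ring
      · simp

/-- The normalizing constant of the Hermite function `h_n`. -/
noncomputable def hermiteNorm (n : ℕ) : ℝ :=
  Real.sqrt (2 ^ n * (n.factorial : ℝ) * Real.sqrt Real.pi)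

theorem hermiteNorm_pos (n : ℕ) : 0 < hermiteNorm n := Real.sqrt_pos.2 (by positivity)

theorem hermiteNorm_sq (n : ℕ) :
    hermiteNorm n ^ 2 = 2 ^ n * (n.factorial : ℝ) * Real.sqrt Real.pi :=
  Real.sq_sqrt (by positivity)

theorem hermiteFun_eq (n : ℕ) (x : ℝ) :
    hermiteFun n x = (hermiteNorm n)⁻¹ * (-1) ^ n * (Real.exp (x ^ 2 / 2) * gaussD n x) := by
  have hE : Real.exp (-x ^ 2 / 2) * Real.exp (x ^ 2) = Real.exp (x ^ 2 / 2) := by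
    rw [← Real.exp_add]; congr 1; ring
  unfold hermiteFun hermiteH hermiteNorm gaussD
  rw [← hE]; ring

theorem hermiteFun_mul_hermiteFun (m n : ℕ) (x : ℝ) :
    hermiteFun m x * hermiteFun n x = (hermiteNorm m)⁻¹ * (hermiteNorm n)⁻¹ * (-1) ^ (m + n) *
      (Real.exp (x ^ 2) * gaussD m x * gaussD n x) := by
  have hE : Real.exp (x ^ 2 / 2) * Real.exp (x ^ 2 / 2) = Real.exp (x ^ 2) := by
    rw [← Real.exp_add]; congr 1; ring
  rw [hermiteFun_eq, hermiteFun_eq, ← hE]; ring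

theorem integrable_hermiteFun_mul (m n : ℕ) :
    Integrable fun x : ℝ => hermiteFun m x * hermiteFun n x := by
  simp only [hermiteFun_mul_hermiteFun]
  exact (integrable_exp_sq_mul_gaussD_mul_gaussD m n).const_mul _

theorem integral_hermiteFun_mul (m n : ℕ) :
    ∫ x : ℝ, hermiteFun m x * hermiteFun n x = if m = n then 1 else 0 := by
  simp only [hermiteFun_mul_hermiteFun]
  rw [integral_const_mul, integral_exp_sq_mul_gaussD_mul_gaussD]
  split_ifs with h
  · subst h
    have := (hermiteNorm_pos m).ne'
    rw [← hermiteNorm_sq, ← two_mul, pow_mul]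
    field_simp; norm_num
  · simp

/-! ### Recursions for the Hermite functions on the line -/

theorem mul_hermiteFun_zero (x : ℝ) :
    x * hermiteFun 0 x = Real.sqrt (1 / 2) * hermiteFun 1 x := by
  have h0 := (hermiteNorm_pos 0).ne'
  have h1 := (hermiteNorm_pos 1).ne'
  have h : hermiteNorm 1 = Real.sqrt 2 * hermiteNorm 0 := by
    unfold hermiteNorm; rw [← Real.sqrt_mul (by norm_num)]; simp
  have h2 : Real.sqrt 2 ≠ 0 := by positivity
  have h3 : Real.sqrt (1 / 2) = (Real.sqrt 2)⁻¹ := by rw [one_div, Real.sqrt_inv]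
  have h4 : Real.sqrt 2 * Real.sqrt 2 = 2 := Real.mul_self_sqrt (by norm_num)
  rw [hermiteFun_eq, hermiteFun_eq, gaussD_one, h, h3]
  field_simp
  rw [sq, h4]; ring

/-- The condition a ≠ 0 allows the recursion to be solved for the function of highest index. -/
theorem exists_mul_hermiteFun_succ (n : ℕ) : ∃ a b : ℝ, a ≠ 0 ∧ ∀ x : ℝ,
    x * hermiteFun (n + 1) x = a * hermiteFun (n + 2) x + b * hermiteFun n x := by
  have h0 := (hermiteNorm_pos n).ne'
  have h1 := (hermiteNorm_pos (n + 1)).ne'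
  have h2 := (hermiteNorm_pos (n + 2)).ne'
  refine ⟨hermiteNorm (n + 2) / (2 * hermiteNorm (n + 1)),
    (n + 1) * hermiteNorm n / hermiteNorm (n + 1), by positivity, fun x => ?_⟩
  rw [hermiteFun_eq, hermiteFun_eq, hermiteFun_eq, gaussD_succ_succ]
  field_simp
  ring

/-- Recursion for the Hermite functions, raising the index. -/
theorem exists_hermiteFun_succ (n : ℕ) : ∃ a b : ℝ, ∀ x : ℝ,
    hermiteFun (n + 1) x = a * (x * hermiteFun n x) + b * hermiteFun (n - 1) x := by
  cases n with
  | zero =>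
    -- In ℕ the index 0 - 1 is 0, so the spurious lower term gets the coefficient 0.
    refine ⟨(Real.sqrt (1 / 2))⁻¹, 0, fun x => ?_⟩
    rw [mul_hermiteFun_zero]
    have : Real.sqrt (1 / 2) ≠ 0 := by positivity
    field_simp; simp
  | succ n =>
    obtain ⟨a, b, ha, h⟩ := exists_mul_hermiteFun_succ n
    refine ⟨a⁻¹, -(a⁻¹ * b), fun x => ?_⟩
    rw [h]; simp only [Nat.add_sub_cancel]; field_simp; ring

/-- Recursion for the Hermite functions: multiplication by the variable. -/
theorem exists_mul_hermiteFun (n : ℕ) : ∃ a b : ℝ, ∀ x : ℝ,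
    x * hermiteFun n x = a * hermiteFun (n + 1) x + b * hermiteFun (n - 1) x := by
  cases n with
  | zero => exact ⟨Real.sqrt (1 / 2), 0, fun x => by simp [mul_hermiteFun_zero]⟩
  | succ n =>
    obtain ⟨a, b, -, h⟩ := exists_mul_hermiteFun_succ n
    exact ⟨a, b, h⟩

/-! ### Hermite functions in several variables -/

variable {d : ℕ}

theorem hermiteFn_mul_hermiteFn (m n : Fin d → ℕ) (x : EuclideanSpace ℝ (Fin d)) :
    hermiteFn m x * hermiteFn n x = ∏ j, hermiteFun (m j) (x j) * hermiteFun (n j) (x j) :=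
  Finset.prod_mul_distrib.symm

theorem integrable_hermiteFn_mul (m n : Fin d → ℕ) :
    Integrable fun x : EuclideanSpace ℝ (Fin d) => hermiteFn m x * hermiteFn n x := by
  simp only [hermiteFn_mul_hermiteFn]
  have h := Integrable.fintype_prod (μ := fun _ : Fin d => (volume : Measure ℝ))
    (f := fun j t => hermiteFun (m j) t * hermiteFun (n j) t)
    fun j => integrable_hermiteFun_mul (m j) (n j)
  exact (PiLp.volume_preserving_ofLp (Fin d)).integrable_comp_of_integrable h

theorem integral_hermiteFn_mul (m n : Fin d → ℕ) :
    ∫ x : EuclideanSpace ℝ (Fin d), hermiteFn m x * hermiteFn n x = if m = n then 1 else 0 := by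
  simp only [hermiteFn_mul_hermiteFn]
  have h := (PiLp.volume_preserving_ofLp (Fin d)).integral_comp
    (MeasurableEquiv.toLp 2 (Fin d → ℝ)).symm.measurableEmbedding
    (fun y : Fin d → ℝ => ∏ j, hermiteFun (m j) (y j) * hermiteFun (n j) (y j))
  rw [h, integral_fintype_prod_volume_eq_prod
    (fun j t => hermiteFun (m j) t * hermiteFun (n j) t)]
  simp only [integral_hermiteFun_mul]
  split_ifs with hmn
  · simp [hmn]
  · obtain ⟨j, hj⟩ := Function.ne_iff.1 hmn
    exact Finset.prod_eq_zero (Finset.mem_univ j) (if_neg hj)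

theorem hermiteFn_update (m : Fin d → ℕ) (j : Fin d) (q : ℕ) (x : EuclideanSpace ℝ (Fin d)) :
    hermiteFn (Function.update m j q) x =
      hermiteFun q (x j) * ∏ i ∈ Finset.univ.erase j, hermiteFun (m i) (x i) := by
  unfold hermiteFn
  rw [← Finset.mul_prod_erase _ _ (Finset.mem_univ j), Function.update_self]
  congr 1
  exact Finset.prod_congr rfl fun i hi => by
    rw [Function.update_of_ne (Finset.ne_of_mem_erase hi)]

theorem sum_update (m : Fin d → ℕ) (j : Fin d) (q : ℕ) :
    ∑ i, Function.update m j q i = q + ∑ i ∈ Finset.univ.erase j, m i := by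
  rw [← Finset.add_sum_erase _ _ (Finset.mem_univ j), Function.update_self]
  congr 1
  exact Finset.sum_congr rfl fun i hi => by
    rw [Function.update_of_ne (Finset.ne_of_mem_erase hi)]

/-- The span of the Hermite functions `h_k` with `|k| ≤ N`. -/
def hermiteSpan (d N : ℕ) : Submodule ℝ (EuclideanSpace ℝ (Fin d) → ℝ) :=
  Submodule.span ℝ (hermiteFn '' {k | ∑ j, k j ≤ N})

theorem hermiteFn_mem_hermiteSpan {k : Fin d → ℕ} {N : ℕ} (h : ∑ j, k j ≤ N) :
    hermiteFn k ∈ hermiteSpan d N :=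
  Submodule.subset_span ⟨k, h, rfl⟩

theorem hermiteSpan_mono {M N : ℕ} (h : M ≤ N) : hermiteSpan d M ≤ hermiteSpan d N :=
  Submodule.span_mono (Set.image_mono fun _ hk => le_trans hk h)

/-- Multiplication by x_j affects only the j-th factor of a Hermite function, and the recursion
changes that index by at most one. -/
theorem coord_mul_mem_hermiteSpan {N : ℕ} {f : EuclideanSpace ℝ (Fin d) → ℝ}
    (hf : f ∈ hermiteSpan d N) (j : Fin d) : (fun x => x j * f x) ∈ hermiteSpan d (N + 1) := by
  induction hf using Submodule.span_induction with
  | mem f hf =>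
    obtain ⟨k, hk, rfl⟩ := hf
    obtain ⟨a, b, h⟩ := exists_mul_hermiteFun (k j)
    have e : (fun x : EuclideanSpace ℝ (Fin d) => x j * hermiteFn k x) =
        a • hermiteFn (Function.update k j (k j + 1)) +
          b • hermiteFn (Function.update k j (k j - 1)) := by
      ext x
      have h1 := hermiteFn_update k j (k j) x
      rw [Function.update_eq_self] at h1
      simp only [Pi.add_apply, Pi.smul_apply, smul_eq_mul, hermiteFn_update, h1]
      rw [← mul_assoc, h]; ring
    rw [e]
    have h2 := sum_update k j (k j)
    rw [Function.update_eq_self] at h2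
    have h3 : ∑ j, k j ≤ N := hk
    refine add_mem (Submodule.smul_mem _ _ (hermiteFn_mem_hermiteSpan ?_))
      (Submodule.smul_mem _ _ (hermiteFn_mem_hermiteSpan ?_)) <;>
    · rw [sum_update]; omega
  | zero =>
    convert zero_mem (hermiteSpan d (N + 1)) using 1
    ext x; simp
  | add f g _ _ hf hg =>
    convert add_mem hf hg using 1
    ext x; simp [mul_add]
  | smul c f _ hf =>
    convert Submodule.smul_mem _ c hf using 1
    ext x; simp only [Pi.smul_apply, smul_eq_mul]; ring

/-- Since h_0 depends on the norm alone, it is fixed by isometries; this starts the induction on the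
order. -/
theorem hermiteFn_zero (x : EuclideanSpace ℝ (Fin d)) :
    hermiteFn 0 x = (hermiteNorm 0)⁻¹ ^ d * Real.exp (-‖x‖ ^ 2 / 2) := by
  have h (t : ℝ) : hermiteFun 0 t = (hermiteNorm 0)⁻¹ * Real.exp (-t ^ 2 / 2) := by
    rw [hermiteFun_eq, gaussD_zero, ← Real.exp_add, pow_zero, mul_one]
    congr 2; ring
  simp only [hermiteFn, Pi.zero_apply, h, Finset.prod_mul_distrib, Finset.prod_const,
    Finset.card_univ, Fintype.card_fin, EuclideanSpace.norm_sq_eq, ← Real.exp_sum,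
    Real.norm_eq_abs, sq_abs, neg_div, Finset.sum_neg_distrib, Finset.sum_div]

/-- The spans of the Hermite functions of bounded order are invariant under isometries. -/
theorem hermiteFn_comp_mem_hermiteSpan
    (e : EuclideanSpace ℝ (Fin d) ≃ₗᵢ[ℝ] EuclideanSpace ℝ (Fin d)) (N : ℕ) :
    ∀ m : Fin d → ℕ, ∑ j, m j = N → (fun x => hermiteFn m (e x)) ∈ hermiteSpan d N := by
  induction N using Nat.strong_induction_on with
  | _ N ih =>
    intro m hm
    by_cases h0 : m = 0
    · have : (fun x => hermiteFn m (e x)) = hermiteFn m := by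
        ext x; rw [h0, hermiteFn_zero, hermiteFn_zero, e.norm_map]
      rw [this]
      exact hermiteFn_mem_hermiteSpan hm.le
    · obtain ⟨j, hj⟩ := Function.ne_iff.1 h0
      -- With m_j = q + 1, the recursion writes h_m(e x) as (e x)_j times a rotated Hermite function
      -- of order N - 1, plus one of order at most N - 1. The factor (e x)_j is a linear combination
      -- of the x_i, and each x_i raises the order by at most one.
      obtain ⟨q, hq⟩ := Nat.exists_eq_succ_of_ne_zero hj
      obtain ⟨a, b, h⟩ := exists_hermiteFun_succ q
      have h1 := sum_update m j (m j)
      rw [Function.update_eq_self] at h1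
      have hlow (p : ℕ) (hp : p ≤ q) :
          (fun x => hermiteFn (Function.update m j p) (e x)) ∈ hermiteSpan d (N - 1) := by
        have h2 := sum_update m j p
        exact hermiteSpan_mono (by omega) (ih _ (by omega) _ rfl)
      have h3 : (fun x => hermiteFn m (e x)) =
          a • (∑ i, (e (EuclideanSpace.single i 1) j) •
            fun x => x i * hermiteFn (Function.update m j q) (e x)) +
          b • fun x => hermiteFn (Function.update m j (q - 1)) (e x) := by
        ext x
        have h4 : hermiteFn m (e x) = a * (e x j * hermiteFn (Function.update m j q) (e x)) +
            b * hermiteFn (Function.update m j (q - 1)) (e x) := by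
          have h5 := hermiteFn_update m j (m j) (e x)
          rw [Function.update_eq_self] at h5
          rw [h5, hermiteFn_update, hermiteFn_update, hq, Nat.succ_eq_add_one, h]; ring
        have h6 : e x j = ∑ i, x i * e (EuclideanSpace.single i 1) j := by
          have h7 : x = ∑ i, x i • EuclideanSpace.single i (1 : ℝ) := by
            ext k; simp [Finset.sum_apply, Pi.single_apply]
          conv_lhs => rw [h7]
          simp
        simp only [Pi.add_apply, Pi.smul_apply, Finset.sum_apply, smul_eq_mul]
        rw [h4, h6, Finset.sum_mul]
        congr 2
        exact Finset.sum_congr rfl fun i _ => by ring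
      rw [h3]
      have hN : N - 1 + 1 = N := by
        have := sum_update m j (m j)
        omega
      refine add_mem (Submodule.smul_mem _ _ (sum_mem fun i _ => Submodule.smul_mem _ _ ?_))
        (Submodule.smul_mem _ _ (hermiteSpan_mono (Nat.sub_le _ _) (hlow _ (Nat.sub_le _ _))))
      have := coord_mul_mem_hermiteSpan (hlow q le_rfl) i
      rwa [hN] at this

/-- The multi-indices of order `N`. -/
def level (d N : ℕ) : Finset (Fin d → ℕ) := Finset.piAntidiag Finset.univ N

@[simp] theorem mem_level {N : ℕ} {k : Fin d → ℕ} : k ∈ level d N ↔ ∑ j, k j = N := by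
  simp [level]

/-- All three claims are linear in f and follow from orthonormality on the generators. Integrability
is carried along because additivity of the integral requires it. -/
theorem hermiteSpan_expansion {N : ℕ} {f : EuclideanSpace ℝ (Fin d) → ℝ}
    (hf : f ∈ hermiteSpan d N) :
    (∀ k, Integrable fun x => f x * hermiteFn k x) ∧
    (∀ k : Fin d → ℕ, N < ∑ j, k j → ∫ x, f x * hermiteFn k x = 0) ∧
    ∀ x, f x = ∑ k ∈ (Finset.range (N + 1)).biUnion (level d),
      (∫ y, f y * hermiteFn k y) * hermiteFn k x := by
  induction hf using Submodule.span_induction with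
  | mem f hf =>
    obtain ⟨m, hm, rfl⟩ := hf
    have hm' : ∑ j, m j ≤ N := hm
    refine ⟨integrable_hermiteFn_mul m, fun k hk => ?_, fun x => ?_⟩
    · rw [integral_hermiteFn_mul, if_neg]
      rintro rfl; omega
    · simp only [integral_hermiteFn_mul, ite_mul, one_mul, zero_mul]
      rw [Finset.sum_ite_eq, if_pos]
      simp; omega
  | zero => simp
  | add f g _ _ hf hg =>
    obtain ⟨hf1, hf2, hf3⟩ := hf
    obtain ⟨hg1, hg2, hg3⟩ := hg
    have h (k : Fin d → ℕ) : ∫ x, (f + g) x * hermiteFn k x =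
        (∫ x, f x * hermiteFn k x) + ∫ x, g x * hermiteFn k x := by
      rw [← integral_add (hf1 k) (hg1 k)]
      simp [add_mul]
    refine ⟨fun k => ((hf1 k).add (hg1 k)).congr (.of_forall fun x => by simp [add_mul]),
      fun k hk => by rw [h, hf2 k hk, hg2 k hk, add_zero], fun x => ?_⟩
    rw [Finset.sum_congr rfl fun k _ => by rw [h k, add_mul], Finset.sum_add_distrib, ← hf3 x,
      ← hg3 x, Pi.add_apply]
  | smul c f _ hf =>
    obtain ⟨hf1, hf2, hf3⟩ := hf
    have h (k : Fin d → ℕ) : ∫ x, (c • f) x * hermiteFn k x =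
        c * ∫ x, f x * hermiteFn k x := by
      rw [← integral_const_mul]
      simp [mul_assoc]
    refine ⟨fun k => ((hf1 k).const_mul c).congr (.of_forall fun x => by simp [mul_assoc]),
      fun k hk => by rw [h, hf2 k hk, mul_zero], fun x => ?_⟩
    rw [Finset.sum_congr rfl fun k _ => by rw [h k, mul_assoc], ← Finset.mul_sum, ← hf3 x,
      Pi.smul_apply, smul_eq_mul]

/-! ### Isometries act on the Hermite functions order by order -/

/-- The matrix coefficients of the action of the isometry `e` on the Hermite functions. -/
noncomputable def rotCoeff (e : EuclideanSpace ℝ (Fin d) ≃ₗᵢ[ℝ] EuclideanSpace ℝ (Fin d))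
    (m k : Fin d → ℕ) : ℝ :=
  ∫ x, hermiteFn m (e x) * hermiteFn k x

section

variable (e : EuclideanSpace ℝ (Fin d) ≃ₗᵢ[ℝ] EuclideanSpace ℝ (Fin d))

theorem integral_comp_mul {𝕜 : Type*} [RCLike 𝕜] (f g : EuclideanSpace ℝ (Fin d) → 𝕜) :
    ∫ x, f (e x) * g x = ∫ x, f x * g (e.symm x) := by
  have h := e.measurePreserving.integral_comp e.toMeasurableEquiv.measurableEmbedding
    (fun x => f x * g (e.symm x))
  simpa using h

/-- Isometries preserve Lebesgue measure, so the inverse isometry acts by the transposed matrix. -/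
theorem rotCoeff_symm (m k : Fin d → ℕ) : rotCoeff e.symm k m = rotCoeff e m k := by
  unfold rotCoeff
  rw [integral_comp_mul]
  simp only [mul_comm, e.symm_symm]

/-- A rotated h_m has no components of order above |m|. Applied to the inverse isometry, the same
fact excludes the lower orders. -/
theorem rotCoeff_eq_zero {m k : Fin d → ℕ} (h : ∑ j, m j ≠ ∑ j, k j) : rotCoeff e m k = 0 := by
  rcases lt_or_gt_of_ne h with h | h
  · exact (hermiteSpan_expansion (hermiteFn_comp_mem_hermiteSpan e _ m rfl)).2.1 k h
  · rw [← rotCoeff_symm]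
    exact (hermiteSpan_expansion (hermiteFn_comp_mem_hermiteSpan e.symm _ k rfl)).2.1 m h

theorem hermiteFn_comp (m : Fin d → ℕ) (x : EuclideanSpace ℝ (Fin d)) :
    hermiteFn m (e x) = ∑ k ∈ level d (∑ j, m j), rotCoeff e m k * hermiteFn k x := by
  rw [(hermiteSpan_expansion (hermiteFn_comp_mem_hermiteSpan e _ m rfl)).2.2 x]
  symm
  refine Finset.sum_subset (Finset.subset_biUnion_of_mem _ (by simp)) fun k _ hk => ?_
  rw [mem_level] at hk
  exact mul_eq_zero_of_left (rotCoeff_eq_zero e (Ne.symm hk)) _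
/-! ### Coefficients of absolutely convergent Hermite series -/

theorem integrable_hermiteFn_comp_mul (m k : Fin d → ℕ) :
    Integrable fun x => hermiteFn m (e x) * hermiteFn k x :=
  (hermiteSpan_expansion (hermiteFn_comp_mem_hermiteSpan e _ m rfl)).1 k

/-- From |uv| ≤ (u² + v²)/2 and unit L² norms. Uniformity in m and k is what permits termwise
integration of a series with summable coefficients. -/
theorem integral_abs_hermiteFn_comp_mul_le (m k : Fin d → ℕ) :
    ∫ x, |hermiteFn m (e x) * hermiteFn k x| ≤ 1 := by
  have h1 : Integrable fun x => hermiteFn m (e x) * hermiteFn m (e x) :=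
    e.measurePreserving.integrable_comp_of_integrable (integrable_hermiteFn_mul m m)
  have h2 := integrable_hermiteFn_mul k k
  have h3 : ∫ x, hermiteFn m (e x) * hermiteFn m (e x) = 1 := by
    rw [integral_comp_mul e (hermiteFn m) fun x => hermiteFn m (e x)]
    simp [integral_hermiteFn_mul]
  have h4 : ∫ x : EuclideanSpace ℝ (Fin d), hermiteFn k x * hermiteFn k x = 1 := by
    simp [integral_hermiteFn_mul]
  calc _ ≤ ∫ x, 1 / 2 * (hermiteFn m (e x) * hermiteFn m (e x) + hermiteFn k x * hermiteFn k x) :=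
        integral_mono (integrable_hermiteFn_comp_mul e m k).abs ((h1.add h2).const_mul _)
          fun x => by
            rw [abs_le]
            constructor <;> nlinarith [sq_nonneg (hermiteFn m (e x) + hermiteFn k x),
              sq_nonneg (hermiteFn m (e x) - hermiteFn k x)]
    _ = 1 := by
        rw [integral_const_mul, integral_add h1 h2, h3, h4]; norm_num

theorem rotCoeff_refl (m k : Fin d → ℕ) :
    rotCoeff (LinearIsometryEquiv.refl ℝ (EuclideanSpace ℝ (Fin d))) m k =
      if m = k then 1 else 0 := by
  simp [rotCoeff, integral_hermiteFn_mul]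

theorem integral_tsum_hermiteFn_comp_mul {a : (Fin d → ℕ) → ℂ} (ha : Summable fun n => ‖a n‖)
    (m : Fin d → ℕ) :
    ∫ x, (∑' n, a n * (hermiteFn n (e x) : ℂ)) * (hermiteFn m x : ℂ) =
      ∑ n ∈ level d (∑ j, m j), (rotCoeff e n m : ℂ) * a n := by
  have h1 (n : Fin d → ℕ) (x : EuclideanSpace ℝ (Fin d)) :
      a n * (hermiteFn n (e x) : ℂ) * (hermiteFn m x : ℂ) =
        a n * ((hermiteFn n (e x) * hermiteFn m x : ℝ) : ℂ) := by push_cast; ring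
  have h2 (n : Fin d → ℕ) :
      Integrable fun x => a n * ((hermiteFn n (e x) * hermiteFn m x : ℝ) : ℂ) :=
    (integrable_hermiteFn_comp_mul e n m).ofReal.const_mul _
  have h3 : Summable fun n => ∫ x, ‖a n * ((hermiteFn n (e x) * hermiteFn m x : ℝ) : ℂ)‖ := by
    refine ha.of_nonneg_of_le (fun n => integral_nonneg fun x => norm_nonneg _) fun n => ?_
    simp only [norm_mul, Complex.norm_real, Real.norm_eq_abs]
    rw [integral_const_mul]
    have h4 := integral_abs_hermiteFn_comp_mul_le e n m
    simp only [abs_mul] at h4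
    exact mul_le_of_le_one_right (norm_nonneg _) h4
  have h5 := integral_tsum_of_summable_integral_norm h2 h3
  simp only [← tsum_mul_right, h1]
  rw [← h5]
  have h6 (n : Fin d → ℕ) : ∫ x, a n * ((hermiteFn n (e x) * hermiteFn m x : ℝ) : ℂ) =
      (rotCoeff e n m : ℂ) * a n := by
    rw [integral_const_mul, integral_complex_ofReal, mul_comm]; rfl
  simp only [h6]
  refine tsum_eq_sum fun n hn => ?_
  rw [mem_level] at hn
  rw [rotCoeff_eq_zero e hn]; simp

/-- The coefficients of the composition of a Hermite series with an isometry. -/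
theorem coeff_eq_of_tsum_hermiteFn_eq_comp {a b : (Fin d → ℕ) → ℂ}
    (ha : Summable fun n => ‖a n‖) (hb : Summable fun n => ‖b n‖)
    (h : ∀ x, ∑' n, b n * (hermiteFn n x : ℂ) = ∑' n, a n * (hermiteFn n (e x) : ℂ))
    (m : Fin d → ℕ) :
    ∑ n ∈ level d (∑ j, m j), (rotCoeff e n m : ℂ) * a n = b m := by
  rw [← integral_tsum_hermiteFn_comp_mul e ha]
  simp only [← h]
  -- The case of the identity isometry: integration against h_m reads off the coefficient b m.
  have h1 := integral_tsum_hermiteFn_comp_mul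
    (LinearIsometryEquiv.refl ℝ (EuclideanSpace ℝ (Fin d))) hb m
  simp only [LinearIsometryEquiv.coe_refl, id] at h1
  rw [h1]
  simp only [rotCoeff_refl, apply_ite Complex.ofReal, Complex.ofReal_one, Complex.ofReal_zero,
    ite_mul, one_mul, zero_mul]
  rw [Finset.sum_ite_eq', if_pos (mem_level.2 rfl)]

/-! ### Invariant sequences and the projection onto them -/

/-- The coefficient sequences that are invariant under the action of all isometries. -/
def invSeq (d : ℕ) : Submodule ℂ ((Fin d → ℕ) → ℂ) where
  carrier := {a | ∀ (e : EuclideanSpace ℝ (Fin d) ≃ₗᵢ[ℝ] EuclideanSpace ℝ (Fin d))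
    (m : Fin d → ℕ), ∑ n ∈ level d (∑ j, m j), (rotCoeff e n m : ℂ) * a n = a m}
  zero_mem' := fun e m => by simp
  add_mem' := fun {a b} ha hb e m => by
    simp only [Pi.add_apply, mul_add, Finset.sum_add_distrib, ha e m, hb e m]
  smul_mem' := fun c a ha e m => by
    simp only [Pi.smul_apply, smul_eq_mul, mul_left_comm _ c, ← Finset.mul_sum, ha e m]

/-- The matrix coefficients are real. Conjugation passes between the bilinear pairing of functionals
with test functions and the Hermitian inner product used for the projection. -/
theorem conj_mem_invSeq {a : (Fin d → ℕ) → ℂ} (ha : a ∈ invSeq d) :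
    (fun n => starRingEnd ℂ (a n)) ∈ invSeq d := fun e m => by
  have h := congrArg (starRingEnd ℂ) (ha e m)
  simpa using h

theorem level_sum_hermiteFn_comp {a : (Fin d → ℕ) → ℂ} (ha : a ∈ invSeq d) (N : ℕ)
    (x : EuclideanSpace ℝ (Fin d)) :
    ∑ n ∈ level d N, a n * (hermiteFn n (e x) : ℂ) = ∑ n ∈ level d N, a n * (hermiteFn n x : ℂ) := by
  have h1 : ∀ n ∈ level d N, a n * (hermiteFn n (e x) : ℂ) =
      ∑ k ∈ level d N, (rotCoeff e n k : ℂ) * a n * (hermiteFn k x : ℂ) := fun n hn => by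
    rw [hermiteFn_comp, mem_level.1 hn]
    push_cast
    rw [Finset.mul_sum]
    exact Finset.sum_congr rfl fun k _ => by ring
  rw [Finset.sum_congr rfl h1, Finset.sum_comm]
  refine Finset.sum_congr rfl fun k hk => ?_
  rw [← Finset.sum_mul, ← mem_level.1 hk, ha e k]

/-- The sequences restricted to the multi-indices of order `N`. -/
noncomputable def levelRestrict (d N : ℕ) :
    ((Fin d → ℕ) → ℂ) →ₗ[ℂ] EuclideanSpace ℂ (level d N) where
  toFun a := WithLp.toLp 2 fun n => a n
  map_add' _ _ := rfl
  map_smul' _ _ := rfl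

@[simp] theorem levelRestrict_apply {N : ℕ} (a : (Fin d → ℕ) → ℂ) (n : level d N) :
    levelRestrict d N a n = a n := rfl

/-- The vectors of order `N` that are invariant under the action of all isometries. -/
noncomputable def invLevel (d N : ℕ) : Submodule ℂ (EuclideanSpace ℂ (level d N)) :=
  (invSeq d).map (levelRestrict d N)

/-- The orthogonal projection, order by order, onto the invariant sequences. -/
noncomputable def seqProj (d : ℕ) : ((Fin d → ℕ) → ℂ) →ₗ[ℂ] ((Fin d → ℕ) → ℂ) where
  toFun a n := (invLevel d (∑ j, n j)).starProjection (levelRestrict d _ a) ⟨n, mem_level.2 rfl⟩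
  map_add' a b := by ext n; simp
  map_smul' c a := by ext n; simp

theorem levelRestrict_seqProj (N : ℕ) (a : (Fin d → ℕ) → ℂ) :
    levelRestrict d N (seqProj d a) = (invLevel d N).starProjection (levelRestrict d N a) := by
  ext ⟨n, hn⟩
  obtain rfl := mem_level.1 hn
  rfl

theorem levelRestrict_ext {a b : (Fin d → ℕ) → ℂ}
    (h : ∀ N, levelRestrict d N a = levelRestrict d N b) : a = b := by
  ext n
  exact congrArg (fun v : EuclideanSpace ℂ (level d (∑ j, n j)) => v ⟨n, mem_level.2 rfl⟩) (h _)

theorem seqProj_eq_self {a : (Fin d → ℕ) → ℂ} (ha : a ∈ invSeq d) : seqProj d a = a :=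
  levelRestrict_ext fun N => by
    rw [levelRestrict_seqProj]
    exact Submodule.starProjection_eq_self_iff.2 ⟨a, ha, rfl⟩

/-- Each invariance equation involves one order only, so in that order the projection may be
replaced by an invariant sequence agreeing with it there. -/
theorem seqProj_mem_invSeq (a : (Fin d → ℕ) → ℂ) : seqProj d a ∈ invSeq d := by
  intro e m
  have h := Submodule.starProjection_apply_mem (invLevel d (∑ j, m j)) (levelRestrict d _ a)
  rw [← levelRestrict_seqProj] at h
  obtain ⟨c, hc, hca⟩ := h
  have h1 : ∀ n ∈ level d (∑ j, m j), seqProj d a n = c n := fun n hn =>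
    (congrArg (fun v : EuclideanSpace ℂ (level d (∑ j, m j)) => v ⟨n, hn⟩) hca).symm
  rw [h1 m (mem_level.2 rfl), ← hc e m]
  exact Finset.sum_congr rfl fun n hn => by rw [h1 n hn]

theorem inner_levelRestrict (N : ℕ) (a b : (Fin d → ℕ) → ℂ) :
    inner ℂ (levelRestrict d N a) (levelRestrict d N b) =
      ∑ n ∈ level d N, starRingEnd ℂ (a n) * b n := by
  rw [PiLp.inner_apply, ← Finset.sum_coe_sort (level d N)]
  exact Finset.sum_congr rfl fun n _ => by simp [mul_comm]

/-- Self-adjointness moves the projection onto the conjugate of b, which it fixes. -/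
theorem level_sum_mul_seqProj {b : (Fin d → ℕ) → ℂ} (hb : b ∈ invSeq d) (N : ℕ)
    (a : (Fin d → ℕ) → ℂ) :
    ∑ n ∈ level d N, b n * seqProj d a n = ∑ n ∈ level d N, b n * a n := by
  have h := Submodule.inner_starProjection_left_eq_right (invLevel d N)
    (levelRestrict d N fun n => starRingEnd ℂ (b n)) (levelRestrict d N a)
  rw [← levelRestrict_seqProj, ← levelRestrict_seqProj, seqProj_eq_self (conj_mem_invSeq hb),
    inner_levelRestrict, inner_levelRestrict] at h
  simpa using h.symm

/-- In each order b - a is orthogonal to every invariant vector c: the transposed matrix, which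
belongs to the inverse isometry, fixes c, so a and its rotation b have the same inner product with
c. -/
theorem seqProj_eq_of_rotCoeff {a b : (Fin d → ℕ) → ℂ}
    (h : ∀ m : Fin d → ℕ, ∑ n ∈ level d (∑ j, m j), (rotCoeff e n m : ℂ) * a n = b m) :
    seqProj d b = seqProj d a := by
  refine levelRestrict_ext fun N => ?_
  rw [levelRestrict_seqProj, levelRestrict_seqProj, ← sub_eq_zero, ← map_sub, ← map_sub,
    Submodule.starProjection_apply_eq_zero_iff, Submodule.mem_orthogonal]
  rintro _ ⟨c, hc, rfl⟩
  rw [map_sub, inner_sub_right, inner_levelRestrict, inner_levelRestrict, sub_eq_zero]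
  have h1 : ∀ m ∈ level d N, starRingEnd ℂ (c m) * b m = ∑ n ∈ level d N,
      starRingEnd ℂ (c m) * (rotCoeff e n m : ℂ) * a n := fun m hm => by
    rw [← h m, mem_level.1 hm, Finset.mul_sum]
    exact Finset.sum_congr rfl fun n _ => by ring
  rw [Finset.sum_congr rfl h1, Finset.sum_comm]
  refine Finset.sum_congr rfl fun n hn => ?_
  rw [← Finset.sum_mul]
  congr 1
  have h2 := conj_mem_invSeq hc e.symm n
  rw [mem_level.1 hn] at h2
  refine Eq.trans (Finset.sum_congr rfl fun m _ => ?_) h2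
  rw [rotCoeff_symm, mul_comm]

/-- The projection contracts the ℓ² norm of a block, which lies between the sup norm and the ℓ¹
norm; the latter is at most the cardinality times C. -/
theorem norm_seqProj_le {a : (Fin d → ℕ) → ℂ} {C : ℝ} (n : Fin d → ℕ)
    (h : ∀ m ∈ level d (∑ j, n j), ‖a m‖ ≤ C) :
    ‖seqProj d a n‖ ≤ (level d (∑ j, n j)).card * C := by
  have hC : 0 ≤ C := (norm_nonneg _).trans (h n (mem_level.2 rfl))
  set N := ∑ j, n j with hN
  have h1 : ‖seqProj d a n‖ ≤ ‖levelRestrict d N (seqProj d a)‖ :=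
    PiLp.norm_apply_le (levelRestrict d N (seqProj d a)) ⟨n, mem_level.2 rfl⟩
  have h2 : ‖levelRestrict d N (seqProj d a)‖ ≤ ‖levelRestrict d N a‖ := by
    rw [levelRestrict_seqProj]
    exact Submodule.norm_starProjection_apply_le _ _
  refine h1.trans (h2.trans ?_)
  rw [EuclideanSpace.norm_eq]
  refine Real.sqrt_le_iff.2 ⟨by positivity, ?_⟩
  calc _ ≤ (∑ m : ↥(level d N), ‖levelRestrict d N a m‖) ^ 2 :=
        Finset.sum_sq_le_sq_sum_of_nonneg fun _ _ => norm_nonneg _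
    _ ≤ _ := by
        refine pow_le_pow_left₀ (Finset.sum_nonneg fun _ _ => norm_nonneg _) ?_ 2
        refine (Finset.sum_le_card_nsmul _ _ C fun m _ => h m.1 m.2).trans ?_
        simp

end

/-! ### The weighted sequence spaces -/

theorem summable_exp_neg_mul_rpow {c p : ℝ} (hc : 0 < c) (hp : 0 < p) :
    Summable fun n : ℕ => Real.exp (-c * (n : ℝ) ^ p) := by
  have h := (isLittleO_exp_neg_mul_rpow_atTop hc (-2 / p)).comp_tendsto
    ((tendsto_rpow_atTop hp).comp tendsto_natCast_atTop_atTop)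
  refine summable_of_isBigO_nat (g := fun n : ℕ => (n : ℝ) ^ (-2 : ℝ))
    (Real.summable_nat_rpow.2 (by norm_num)) (h.isBigO.congr (fun n => rfl) fun n => ?_)
  simp only [Function.comp_apply]
  rw [← Real.rpow_mul (Nat.cast_nonneg n)]
  congr 1; field_simp

theorem summable_inv_weight {s r : ℝ} (hs : 0 < s) (hr : 0 < r) :
    Summable fun n : Fin d → ℕ => (weight s r n)⁻¹ := by
  have hp : 0 < 1 / (2 * s) := by positivity
  have hd : (0 : ℝ) < d + 1 := by positivity
  -- Since each n_j ≤ |n|, spreading r over the coordinates bounds the reciprocal weight by a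
  -- product of one-variable terms. The divisor d + 1, in place of d, is never zero.
  have hsum := summable_pi_prod (d := d)
    (f := fun _ n => Real.exp (-(r / (d + 1)) * (n : ℝ) ^ (1 / (2 * s))))
    (fun _ _ => (Real.exp_pos _).le) (fun _ => summable_exp_neg_mul_rpow (div_pos hr hd) hp)
  refine hsum.of_nonneg_of_le (fun n => (inv_pos.2 (weight_pos _ _ _)).le) fun n => ?_
  rw [weight, ← Real.exp_neg, ← Real.exp_sum, Real.exp_le_exp, ← Finset.mul_sum]
  have h1 : ∑ j, (n j : ℝ) ^ (1 / (2 * s)) ≤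
      (d + 1) * ((∑ j, n j : ℕ) : ℝ) ^ (1 / (2 * s)) := by
    have h2 : ∀ j ∈ Finset.univ, (n j : ℝ) ^ (1 / (2 * s)) ≤
        ((∑ j, n j : ℕ) : ℝ) ^ (1 / (2 * s)) := fun j hj =>
      Real.rpow_le_rpow (Nat.cast_nonneg _)
        (Nat.cast_le.2 (Finset.single_le_sum (fun _ _ => Nat.zero_le _) hj)) hp.le
    have h3 := Finset.sum_le_card_nsmul _ _ _ h2
    rw [Finset.card_univ, Fintype.card_fin, nsmul_eq_mul] at h3
    have h4 : 0 ≤ ((∑ j, n j : ℕ) : ℝ) ^ (1 / (2 * s)) := Real.rpow_nonneg (Nat.cast_nonneg _) _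
    linarith
  have h5 := mul_le_mul_of_nonneg_left h1 (div_pos hr hd).le
  have h6 : r / (d + 1) * ((d + 1) * ((∑ j, n j : ℕ) : ℝ) ^ (1 / (2 * s))) =
      r * ((∑ j, n j : ℕ) : ℝ) ^ (1 / (2 * s)) := by field_simp
  linarith

theorem mem_weightedLinf {s r : ℝ} {a : (Fin d → ℕ) → ℂ} :
    a ∈ weightedLinf d s r ↔ ∃ C, ∀ n, ‖a n‖ * weight s r n ≤ C := by
  change Memℓp (fun n => weight s r n • a n) ⊤ ↔ _
  rw [memℓp_infty_iff, BddAbove]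
  simp only [Set.Nonempty, mem_upperBounds, Set.forall_mem_range, norm_smul,
    Real.norm_eq_abs, abs_of_pos (weight_pos _ _ _), mul_comm]

theorem summable_norm_of_mem_weightedLinf {s r : ℝ} (hs : 0 < s) (hr : 0 < r)
    {a : (Fin d → ℕ) → ℂ} (ha : a ∈ weightedLinf d s r) : Summable fun n => ‖a n‖ := by
  obtain ⟨C, hC⟩ := mem_weightedLinf.1 ha
  refine ((summable_inv_weight hs hr).mul_left C).of_nonneg_of_le (fun n => norm_nonneg _)
    fun n => ?_
  rw [← div_eq_mul_inv, le_div_iff₀ (weight_pos _ _ _)]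
  exact hC n

theorem Step.norm_coeff_mul_weight_le {s r : ℝ} (a : Step d s r) (n : Fin d → ℕ) :
    ‖a.1 n‖ * weight s r n ≤ ‖a‖ := by
  have h := lp.norm_apply_le_norm ENNReal.top_ne_zero (Step.toLinf d s r a) n
  change ‖weight s r n • a.1 n‖ ≤ ‖a‖ at h
  rwa [norm_smul, Real.norm_eq_abs, abs_of_pos (weight_pos _ _ _), mul_comm] at h

theorem Step.norm_le_of_forall {s r : ℝ} {a : Step d s r} {C : ℝ}
    (h : ∀ n, ‖a.1 n‖ * weight s r n ≤ C) : ‖a‖ ≤ C := by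
  rw [Step.norm_def]
  exact ciSup_le h

theorem weight_mul {s r r' : ℝ} (n : Fin d → ℕ) :
    weight s r n * weight s r' n = weight s (r + r') n := by
  rw [weight, weight, weight, ← Real.exp_add, add_mul]

theorem weight_eq_of_mem_level {s r : ℝ} {m n : Fin d → ℕ} (h : m ∈ level d (∑ j, n j)) :
    weight s r m = weight s r n := by
  rw [weight, weight, mem_level.1 h]

/-- The weight is constant on a block, so the block contributes its cardinality over the weight to
the convergent sum of reciprocal weights. -/
theorem card_level_le {s r : ℝ} (hs : 0 < s) (hr : 0 < r) (n : Fin d → ℕ) :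
    ((level d (∑ j, n j)).card : ℝ) ≤
      (∑' m : Fin d → ℕ, (weight s r m)⁻¹) * weight s r n := by
  have h := (summable_inv_weight (d := d) hs hr).sum_le_tsum (level d (∑ j, n j))
    fun m _ => (inv_pos.2 (weight_pos s r m)).le
  rw [Finset.sum_congr rfl fun m hm => by rw [weight_eq_of_mem_level hm], Finset.sum_const,
    nsmul_eq_mul, ← div_eq_mul_inv, div_le_iff₀ (weight_pos _ _ _)] at h
  exact h

theorem norm_seqProj_mul_weight_le {s r r' : ℝ} (hs : 0 < s) (h : r' < r)
    {a : (Fin d → ℕ) → ℂ} {C : ℝ} (hC : ∀ n, ‖a n‖ * weight s r n ≤ C) (n : Fin d → ℕ) :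
    ‖seqProj d a n‖ * weight s r' n ≤ (∑' m : Fin d → ℕ, (weight s (r - r') m)⁻¹) * C := by
  have hw := weight_pos s r n
  have h1 := norm_seqProj_le (C := C / weight s r n) (a := a) n fun m hm => by
    rw [le_div_iff₀ hw, ← weight_eq_of_mem_level hm]
    exact hC m
  have h2 : 0 ≤ C := (mul_nonneg (norm_nonneg _) hw.le).trans (hC n)
  calc _ ≤ ((level d (∑ j, n j)).card * (C / weight s r n)) * weight s r' n :=
        mul_le_mul_of_nonneg_right h1 (weight_pos _ _ _).le
    _ ≤ ((∑' m : Fin d → ℕ, (weight s (r - r') m)⁻¹) * weight s (r - r') n *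
          (C / weight s r n)) * weight s r' n :=
        mul_le_mul_of_nonneg_right (mul_le_mul_of_nonneg_right
          (card_level_le hs (sub_pos.2 h) n) (by positivity)) (weight_pos _ _ _).le
    _ = (∑' m : Fin d → ℕ, (weight s (r - r') m)⁻¹) * (C / weight s r n) *
          (weight s (r - r') n * weight s r' n) := by ring
    _ = _ := by rw [weight_mul, sub_add_cancel]; field_simp

theorem seqProj_mem_weightedLinf {s r r' : ℝ} (hs : 0 < s) (h : r' < r)
    {a : (Fin d → ℕ) → ℂ} (ha : a ∈ weightedLinf d s r) : seqProj d a ∈ weightedLinf d s r' := by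
  obtain ⟨C, hC⟩ := mem_weightedLinf.1 ha
  exact mem_weightedLinf.2 ⟨_, norm_seqProj_mul_weight_le hs h hC⟩

/-- The projection onto the invariant sequences, from one weighted space to a larger one. -/
noncomputable def Step.proj {s r r' : ℝ} (hs : 0 < s) (h : r' < r) :
    Step d s r →L[ℂ] Step d s r' :=
  LinearMap.mkContinuous
    { toFun := fun a => ⟨seqProj d a.1, seqProj_mem_weightedLinf hs h a.2⟩
      map_add' := fun a b => Subtype.ext (map_add (seqProj d) a.1 b.1)
      map_smul' := fun c a => Subtype.ext (map_smul (seqProj d) c a.1) }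
    (∑' m : Fin d → ℕ, (weight s (r - r') m)⁻¹)
    fun a => Step.norm_le_of_forall
      (norm_seqProj_mul_weight_le hs h a.norm_coeff_mul_weight_le)

/-! ### Convergence of Hermite expansions summed by order -/

/-- The multi-indices of order less than `N`. -/
def levelsBelow (d N : ℕ) : Finset (Fin d → ℕ) := (Finset.range N).biUnion (level d)

@[simp] theorem mem_levelsBelow {N : ℕ} {k : Fin d → ℕ} :
    k ∈ levelsBelow d N ↔ ∑ j, k j < N := by
  simp [levelsBelow]

theorem sum_levelsBelow {M : Type*} [AddCommMonoid M] (N : ℕ) (f : (Fin d → ℕ) → M) :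
    ∑ n ∈ levelsBelow d N, f n = ∑ k ∈ Finset.range N, ∑ n ∈ level d k, f n := by
  refine Finset.sum_biUnion fun i _ j _ hij => Finset.disjoint_left.2 fun n hi hj => hij ?_
  rw [← mem_level.1 hi, mem_level.1 hj]

theorem tendsto_levelsBelow : Filter.Tendsto (levelsBelow d) Filter.atTop Filter.atTop :=
  Filter.tendsto_atTop_finset_of_monotone
    (fun _ _ h _ hk => mem_levelsBelow.2 ((mem_levelsBelow.1 hk).trans_le h))
    fun k => ⟨∑ j, k j + 1, by simp⟩

/-- The sequence with a single nonzero term, equal to one. -/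
def unitSeq (m : Fin d → ℕ) : (Fin d → ℕ) → ℂ := Pi.single m 1

theorem unitSeq_mem_weightedLinf (s r : ℝ) (m : Fin d → ℕ) : unitSeq m ∈ weightedLinf d s r := by
  refine mem_weightedLinf.2 ⟨weight s r m, fun n => ?_⟩
  rcases eq_or_ne n m with rfl | h
  · simp [unitSeq]
  · simpa [unitSeq, h] using (weight_pos s r m).le

theorem sum_smul_unitSeq_apply (N : ℕ) (a : (Fin d → ℕ) → ℂ) (n : Fin d → ℕ) :
    (∑ m ∈ levelsBelow d N, a m • unitSeq m) n = if ∑ j, n j < N then a n else 0 := by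
  simp [Finset.sum_apply, unitSeq, Pi.single_apply]

/-- The sequence with a single nonzero term, as an element of a weighted space. -/
def Step.unit {s r : ℝ} (m : Fin d → ℕ) : Step d s r :=
  ⟨unitSeq m, unitSeq_mem_weightedLinf s r m⟩

theorem tendsto_exp_neg_mul_rpow {c p : ℝ} (hc : 0 < c) (hp : 0 < p) :
    Filter.Tendsto (fun n : ℕ => Real.exp (-c * (n : ℝ) ^ p)) Filter.atTop (nhds 0) :=
  (summable_exp_neg_mul_rpow hc hp).tendsto_atTop_zero

/-- In the sup norm with parameter r the tails need not tend to zero. With r' < r the tail from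
order N on is at most C exp(-(r - r') N^{1/(2s)}). -/
theorem Step.tendsto_sum {s r r' : ℝ} (hs : 0 < s) (h : r' < r) (a : Step d s r')
    (ha : a.1 ∈ weightedLinf d s r) :
    Filter.Tendsto (fun N => ∑ n ∈ levelsBelow d N, a.1 n • (Step.unit n : Step d s r'))
      Filter.atTop (nhds a) := by
  obtain ⟨C, hC⟩ := mem_weightedLinf.1 ha
  have hp : 0 < 1 / (2 * s) := by positivity
  rw [tendsto_iff_norm_sub_tendsto_zero]
  have hC0 : 0 ≤ C := (mul_nonneg (norm_nonneg _) (weight_pos s r 0).le).trans (hC 0)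
  have hlim := (tendsto_exp_neg_mul_rpow (sub_pos.2 h) hp).const_mul C
  rw [mul_zero] at hlim
  refine squeeze_zero (fun N => norm_nonneg _) (fun N => ?_) hlim
  refine Step.norm_le_of_forall fun n => ?_
  have h1 : (∑ n ∈ levelsBelow d N, a.1 n • (Step.unit n : Step d s r') - a).1 n = (if ∑ j, n j < N then a.1 n else 0) - a.1 n := by
    have h2 : (∑ n ∈ levelsBelow d N, a.1 n • (Step.unit n : Step d s r')).1 =
        ∑ n ∈ levelsBelow d N, a.1 n • unitSeq n :=
      map_sum (weightedLinf d s r').subtype (fun n => a.1 n • (Step.unit n : Step d s r')) _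
    rw [← sum_smul_unitSeq_apply, ← h2]
    rfl
  rw [h1]
  split_ifs with hn
  · rw [sub_self, norm_zero, zero_mul]; positivity
  · rw [zero_sub, norm_neg]
    have h3 : weight s r' n = weight s r n * weight s (r' - r) n := by
      rw [weight_mul]; congr 1; ring
    rw [h3, ← mul_assoc]
    refine mul_le_mul (hC n) ?_ (weight_pos _ _ _).le hC0
    rw [weight, Real.exp_le_exp]
    have h4 : (N : ℝ) ^ (1 / (2 * s)) ≤ ((∑ j, n j : ℕ) : ℝ) ^ (1 / (2 * s)) :=
      Real.rpow_le_rpow (Nat.cast_nonneg _) (Nat.cast_le.2 (not_lt.1 hn)) hp.le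
    nlinarith

/-! ### Isometries and radial functions -/

theorem exists_isometry_of_orthogonalGroup (A : Matrix.orthogonalGroup (Fin d) ℝ) :
    ∃ e : EuclideanSpace ℝ (Fin d) ≃ₗᵢ[ℝ] EuclideanSpace ℝ (Fin d),
      ∀ x, Matrix.toEuclideanLin (A⁻¹).1 x = e x :=
  ⟨Unitary.linearIsometryEquiv ⟨Matrix.toEuclideanCLM (𝕜 := ℝ) (A⁻¹).1,
    Unitary.map_mem _ (A⁻¹).2⟩, fun _ => rfl⟩

theorem exists_orthogonalGroup_of_isometry
    (e : EuclideanSpace ℝ (Fin d) ≃ₗᵢ[ℝ] EuclideanSpace ℝ (Fin d)) :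
    ∃ A : Matrix.orthogonalGroup (Fin d) ℝ, ∀ x, Matrix.toEuclideanLin (A⁻¹).1 x = e x := by
  let U := Unitary.linearIsometryEquiv.symm e
  let B : Matrix.orthogonalGroup (Fin d) ℝ :=
    ⟨(Matrix.toEuclideanCLM (𝕜 := ℝ) (n := Fin d)).symm U.1,
      Unitary.map_mem (Matrix.toEuclideanCLM (𝕜 := ℝ) (n := Fin d)).symm U.2⟩
  -- The invariance condition composes with A⁻¹, so A is the inverse of the matrix of e.
  refine ⟨B⁻¹, fun x => ?_⟩
  rw [inv_inv]
  change Matrix.toEuclideanCLM (𝕜 := ℝ) (n := Fin d) B.1 x = e x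
  rw [show Matrix.toEuclideanCLM (𝕜 := ℝ) (n := Fin d) B.1 = U.1 from
    StarAlgEquiv.apply_symm_apply _ _]
  rfl

/-- The reflection in the orthogonal complement of x - y exchanges two vectors of equal norm. -/
theorem exists_isometry_apply_eq {x y : EuclideanSpace ℝ (Fin d)} (h : ‖x‖ = ‖y‖) :
    ∃ e : EuclideanSpace ℝ (Fin d) ≃ₗᵢ[ℝ] EuclideanSpace ℝ (Fin d), e x = y :=
  ⟨_, Submodule.reflection_sub h⟩

theorem exists_eq_comp_nnnorm {F : EuclideanSpace ℝ (Fin d) → ℂ}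
    (h : ∀ (e : EuclideanSpace ℝ (Fin d) ≃ₗᵢ[ℝ] EuclideanSpace ℝ (Fin d)) x, F (e x) = F x) :
    ∃ g : NNReal → ℂ, ∀ x, F x = g ‖x‖₊ := by
  classical
  -- The value 0 is used only where r is not the norm of any vector.
  refine ⟨fun r => if hr : ∃ y : EuclideanSpace ℝ (Fin d), ‖y‖₊ = r then F hr.choose else 0,
    fun x => ?_⟩
  have hx : ∃ y : EuclideanSpace ℝ (Fin d), ‖y‖₊ = ‖x‖₊ := ⟨x, rfl⟩
  obtain ⟨e, he⟩ := exists_isometry_apply_eq (congrArg NNReal.toReal hx.choose_spec)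
  simp only [dif_pos hx]
  rw [← h e hx.choose, he]

/-! ### The dual of a space of Hermite series -/

section Dual

variable {𝒜 : Type} [AddCommGroup 𝒜] [Module ℂ 𝒜] [TopologicalSpace 𝒜]

/-- A topological vector space of Hermite series, with functions `ev`, coefficients `coeff` and
Hermite functions `unit`, on which the projection onto the invariant sequences acts as `P`. -/
structure IsHermiteSpace (ev : 𝒜 →ₗ[ℂ] (EuclideanSpace ℝ (Fin d) → ℂ))
    (coeff : 𝒜 →ₗ[ℂ] ((Fin d → ℕ) → ℂ)) (unit : (Fin d → ℕ) → 𝒜) (P : 𝒜 →L[ℂ] 𝒜) : Prop where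
  injective : Function.Injective coeff
  summable : ∀ a, Summable fun n => ‖coeff a n‖
  hasSum : ∀ a x, HasSum (fun n => coeff a n * (hermiteFn n x : ℂ)) (ev a x)
  coeff_unit : ∀ n, coeff (unit n) = unitSeq n
  tendsto : ∀ a, Filter.Tendsto (fun N => ∑ n ∈ levelsBelow d N, coeff a n • unit n)
    Filter.atTop (nhds a)
  coeff_proj : ∀ a, coeff (P a) = seqProj d (coeff a)

namespace IsHermiteSpace

variable {ev : 𝒜 →ₗ[ℂ] (EuclideanSpace ℝ (Fin d) → ℂ)} {coeff : 𝒜 →ₗ[ℂ] ((Fin d → ℕ) → ℂ)}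
  {unit : (Fin d → ℕ) → 𝒜} {P : 𝒜 →L[ℂ] 𝒜}

theorem ev_unit (H : IsHermiteSpace ev coeff unit P) (n : Fin d → ℕ)
    (x : EuclideanSpace ℝ (Fin d)) : ev (unit n) x = (hermiteFn n x : ℂ) := by
  refine (H.hasSum (unit n) x).unique ?_
  rw [H.coeff_unit]
  convert hasSum_ite_eq n (hermiteFn n x : ℂ) using 2 with m
  by_cases h : m = n
  · subst h; simp [unitSeq]
  · simp [unitSeq, h]

theorem sum_coeff_eq (H : IsHermiteSpace ev coeff unit P)
    (e : EuclideanSpace ℝ (Fin d) ≃ₗᵢ[ℝ] EuclideanSpace ℝ (Fin d)) {φ ψ : 𝒜}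
    (h : ∀ x, ev ψ x = ev φ (e x)) (m : Fin d → ℕ) :
    ∑ n ∈ level d (∑ j, m j), (rotCoeff e n m : ℂ) * coeff φ n = coeff ψ m :=
  coeff_eq_of_tsum_hermiteFn_eq_comp e (H.summable φ) (H.summable ψ)
    (fun x => by rw [(H.hasSum ψ x).tsum_eq, (H.hasSum φ (e x)).tsum_eq, h]) m

theorem coeff_mem_invSeq (H : IsHermiteSpace ev coeff unit P) {φ : 𝒜} (hφ : φ ∈ radialTest ev) :
    coeff φ ∈ invSeq d := by
  obtain ⟨g, hg⟩ := hφ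
  exact fun e m => H.sum_coeff_eq e (fun x => by rw [hg, hg, e.nnnorm_map]) m

/-- Partial sums over whole orders are already invariant under isometries, and invariance passes to
the pointwise limit. -/
theorem mem_radialTest (H : IsHermiteSpace ev coeff unit P) {φ : 𝒜} (hφ : coeff φ ∈ invSeq d) :
    φ ∈ radialTest ev := by
  refine exists_eq_comp_nnnorm fun e x => ?_
  refine tendsto_nhds_unique ((H.hasSum φ (e x)).comp tendsto_levelsBelow) ?_
  refine ((H.hasSum φ x).comp tendsto_levelsBelow).congr fun N => ?_
  simp only [Function.comp_apply, sum_levelsBelow]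
  exact Finset.sum_congr rfl fun k _ => (level_sum_hermiteFn_comp e hφ k x).symm

theorem proj_mem_radialTest (H : IsHermiteSpace ev coeff unit P) (φ : 𝒜) :
    P φ ∈ radialTest ev :=
  H.mem_radialTest (by rw [H.coeff_proj]; exact seqProj_mem_invSeq _)

theorem proj_eq_self (H : IsHermiteSpace ev coeff unit P) {φ : 𝒜} (hφ : φ ∈ radialTest ev) :
    P φ = φ :=
  H.injective (by rw [H.coeff_proj, seqProj_eq_self (H.coeff_mem_invSeq hφ)])

theorem proj_eq_of_comp (H : IsHermiteSpace ev coeff unit P)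
    (e : EuclideanSpace ℝ (Fin d) ≃ₗᵢ[ℝ] EuclideanSpace ℝ (Fin d)) {φ ψ : 𝒜}
    (h : ∀ x, ev ψ x = ev φ (e x)) : P ψ = P φ :=
  H.injective (by
    rw [H.coeff_proj, H.coeff_proj, seqProj_eq_of_rotCoeff e (H.sum_coeff_eq e h)])

/-- A rotated Hermite function is a finite combination of Hermite functions, hence a test function
to which the invariance of f applies. -/
theorem apply_unit_mem_invSeq (H : IsHermiteSpace ev coeff unit P) {f : StrongDual ℂ 𝒜}
    (hf : f ∈ radialDual ev) : (fun n => f (unit n)) ∈ invSeq d := by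
  intro e m
  -- The sum in the definition of `invSeq` runs over the first index of `rotCoeff`, so by
  -- transposition the inverse of e is the isometry to use.
  obtain ⟨A, hA⟩ := exists_orthogonalGroup_of_isometry e.symm
  have h := hf A (unit m) (∑ n ∈ level d (∑ j, m j), (rotCoeff e n m : ℂ) • unit n) fun x => by
    rw [hA, H.ev_unit, hermiteFn_comp, map_sum, Finset.sum_apply, Complex.ofReal_sum]
    refine Finset.sum_congr rfl fun n _ => ?_
    rw [map_smul, Pi.smul_apply, H.ev_unit, rotCoeff_symm, Complex.ofReal_mul, smul_eq_mul]
  rw [map_sum] at h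
  simpa using h

/-- By continuity f is determined by its values on partial sums over whole orders. There f pairs
coefficients with the invariant sequence f(h_n), and this pairing does not see the projection. -/
theorem apply_proj (H : IsHermiteSpace ev coeff unit P) {f : StrongDual ℂ 𝒜}
    (hf : f ∈ radialDual ev) (φ : 𝒜) : f (P φ) = f φ := by
  refine tendsto_nhds_unique ((f.continuous.tendsto _).comp (H.tendsto (P φ))) ?_
  refine ((f.continuous.tendsto _).comp (H.tendsto φ)).congr fun N => ?_
  simp only [Function.comp_apply, map_sum, map_smul, smul_eq_mul, H.coeff_proj, sum_levelsBelow]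
  refine Finset.sum_congr rfl fun k _ => ?_
  have h := level_sum_mul_seqProj (H.apply_unit_mem_invSeq hf) k (coeff φ)
  simp only [mul_comm (f _)] at h
  exact h.symm

/-- Restriction to the radial functions is a topological isomorphism from the radial functionals
onto the dual of the space of radial functions. -/
theorem exists_restriction_equiv [IsTopologicalAddGroup 𝒜] [ContinuousSMul ℂ 𝒜]
    (H : IsHermiteSpace ev coeff unit P) :
    ∃ Ψ : radialDual ev ≃L[ℂ] StrongDual ℂ (radialTest ev), ∀ f φ, Ψ f φ = f.1 φ.1 := by
  let Q : 𝒜 →L[ℂ] radialTest ev := P.codRestrict _ H.proj_mem_radialTest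
  let R : radialDual ev →L[ℂ] StrongDual ℂ (radialTest ev) :=
    (ContinuousLinearMap.precomp ℂ (radialTest ev).subtypeL).comp (radialDual ev).subtypeL
  let S : StrongDual ℂ (radialTest ev) →L[ℂ] radialDual ev :=
    -- The functional g ∘ Q is radial because a test function and its rotations have the same
    -- projection.
    (ContinuousLinearMap.precomp ℂ Q).codRestrict _ fun g A φ ψ h => by
      obtain ⟨e, he⟩ := exists_isometry_of_orthogonalGroup A
      exact congrArg g (Subtype.ext (H.proj_eq_of_comp e fun x => by rw [h, he]))
  refine ⟨ContinuousLinearEquiv.equivOfInverse R S (fun f => ?_) fun g => ?_, fun f φ => rfl⟩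
  · exact Subtype.ext (ContinuousLinearMap.ext fun φ => H.apply_proj f.2 φ)
  · exact ContinuousLinearMap.ext fun φ => congrArg g (Subtype.ext (H.proj_eq_self φ.2))

end IsHermiteSpace

end Dual

/-! ### The space of Roumieu type -/

namespace Roumieu

variable {s : ℝ}

theorem continuous_ofStep {r : ℝ} (hr : 0 < r) : Continuous (ofStep (d := d) (s := s) hr) :=
  continuous_sInf_rng.2 fun _ ht => ht.1 r hr

/-- A linear map on the inductive limit is continuous as soon as it is so on every step. -/
theorem continuous_of_comp_ofStep {F : Type} [AddCommGroup F] [Module ℂ F] [TopologicalSpace F]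
    [IsTopologicalAddGroup F] [ContinuousSMul ℂ F] [LocallyConvexSpace ℝ F]
    (T : Roumieu d s →ₗ[ℂ] F)
    (hT : ∀ (r : ℝ) (hr : 0 < r), Continuous fun a : Step d s r => T (ofStep hr a)) :
    Continuous T := by
  -- The topology induced by T is a locally convex vector space topology making every inclusion
  -- continuous, so the inductive limit topology is finer.
  refine continuous_iff_le_induced.2 (sInf_le ⟨fun r hr => ?_, ?_, ?_, ?_⟩)
  · exact continuous_induced_rng.2 (hT r hr)
  · exact topologicalAddGroup_induced T
  · exact continuousSMul_induced T
  · exact .induced (T.restrictScalars ℝ)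

/-- The projection onto the radial functions, as a linear map. -/
noncomputable def projLin (hs : 0 < s) : Roumieu d s →ₗ[ℂ] Roumieu d s where
  toFun a := ⟨seqProj d (coeff a), by
    obtain ⟨r, hr, ha⟩ := a.2
    exact ⟨r / 2, half_pos hr, seqProj_mem_weightedLinf hs (half_lt_self hr) ha⟩⟩
  map_add' a b := Subtype.ext (map_add (seqProj d) (coeff a) (coeff b))
  map_smul' c a := Subtype.ext (map_smul (seqProj d) c (coeff a))

/-- The projection onto the radial functions. -/
noncomputable def proj (hs : 0 < s) : Roumieu d s →L[ℂ] Roumieu d s where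
  toLinearMap := projLin hs
  cont := continuous_of_comp_ofStep (projLin hs) fun _ hr =>
    (continuous_ofStep (half_pos hr)).comp (Step.proj (d := d) hs (half_lt_self hr)).continuous

theorem isHermiteSpace (hs : 0 < s) :
    IsHermiteSpace (eval (d := d) hs) coeff
      (fun n => ofStep one_pos (Step.unit n : Step d s 1)) (proj hs) where
  injective := Subtype.val_injective
  summable a := by
    obtain ⟨r, hr, ha⟩ := a.2
    exact summable_norm_of_mem_weightedLinf hs hr ha
  hasSum a x := by
    obtain ⟨r, hr, ha⟩ := a.2
    exact (summable_hermite_series hs hr ha x).hasSum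
  coeff_unit n := rfl
  tendsto a := by
    obtain ⟨r, hr, ha⟩ := a.2
    -- The series of an element of the step r converges in the larger step r/2, and hence in the
    -- inductive limit.
    have h := ((continuous_ofStep (half_pos hr)).tendsto _).comp (Step.tendsto_sum hs
      (half_lt_self hr) ⟨a.1, weightedLinf_anti d s (half_lt_self hr).le ha⟩ ha)
    refine h.congr fun N => ?_
    rw [Function.comp_apply, map_sum]
    rfl
  coeff_proj a := rfl

end Roumieu

/-! ### The space of Beurling type -/

namespace Beurling

variable {s : ℝ}

theorem continuous_toStep {r : ℝ} (hr : 0 < r) : Continuous (toStep (d := d) (s := s) hr) :=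
  continuous_iInf_dom (i := r) (continuous_iInf_dom (i := hr) continuous_induced_dom)

theorem tendsto_iff {ι : Type} {l : Filter ι} {u : ι → Beurling d s} {a : Beurling d s} :
    Filter.Tendsto u l (nhds a) ↔ ∀ (r : ℝ) (hr : 0 < r),
      Filter.Tendsto (fun i => toStep hr (u i)) l (nhds (toStep hr a)) := by
  simp only [nhds_iInf, Filter.tendsto_iInf, nhds_induced, Filter.tendsto_comap_iff]
  rfl

/-- The projection onto the radial functions. -/
noncomputable def proj (hs : 0 < s) : Beurling d s →L[ℂ] Beurling d s where
  toFun a := ⟨seqProj d (coeff a), fun r hr =>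
    seqProj_mem_weightedLinf hs (lt_add_one r) (a.2 (r + 1) (by positivity))⟩
  map_add' a b := Subtype.ext (map_add (seqProj d) (coeff a) (coeff b))
  map_smul' c a := Subtype.ext (map_smul (seqProj d) c (coeff a))
  -- The norm with parameter r of the projection is controlled by the norm of the argument with
  -- parameter r + 1.
  cont := continuous_iInf_rng.2 fun r => continuous_iInf_rng.2 fun hr =>
    continuous_induced_rng.2 ((Step.proj (d := d) hs (lt_add_one r)).continuous.comp
      (continuous_toStep (by positivity)))

/-- The Hermite function `h_n`, as an element of the space of Beurling type. -/
def unit (n : Fin d → ℕ) : Beurling d s := ⟨unitSeq n, fun r _ => unitSeq_mem_weightedLinf s r n⟩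

theorem isHermiteSpace (hs : 0 < s) :
    IsHermiteSpace (eval (d := d) hs) coeff unit (proj hs) where
  injective := Subtype.val_injective
  summable a := summable_norm_of_mem_weightedLinf hs one_pos (a.2 1 one_pos)
  hasSum a x := (summable_hermite_series hs one_pos (a.2 1 one_pos) x).hasSum
  coeff_unit n := rfl
  tendsto a := by
    refine tendsto_iff.2 fun r hr => ?_
    refine (Step.tendsto_sum hs (lt_add_one r) (toStep hr a)
      (a.2 (r + 1) (by positivity))).congr fun N => ?_
    rw [map_sum]
    rfl
  coeff_proj a := rfl

end Beurling

end Pilipovic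

theorem proposition2p8 (d : ℕ) (hd : 0 < d) (α : ℝ) (hα : 0 < α) :
    (∃ Ψ : Pilipovic.radialDual (Pilipovic.Roumieu.eval (d := d) (half_pos hα)) ≃L[ℂ]
        StrongDual ℂ (Pilipovic.radialTest (Pilipovic.Roumieu.eval (d := d) (half_pos hα))),
      ∀ f φ, Ψ f φ = f.1 φ.1) ∧
    (∃ Ψ : Pilipovic.radialDual (Pilipovic.Beurling.eval (d := d) (half_pos hα)) ≃L[ℂ]
        StrongDual ℂ (Pilipovic.radialTest (Pilipovic.Beurling.eval (d := d) (half_pos hα))),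
      ∀ f φ, Ψ f φ = f.1 φ.1) :=
  ⟨(Pilipovic.Roumieu.isHermiteSpace (half_pos hα)).exists_restriction_equiv,
    (Pilipovic.Beurling.isHermiteSpace (half_pos hα)).exists_restriction_equiv⟩
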